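/- **Definitions.** A *base set* is a set $X$ with $\emptyset\notin X$ none of whose elements has a member in the superstructure $V(X)=\bigcup_n V_n(X)$, where $V_0(X)=X$ and $V_{n+1}(X)=V_n(X)\cup\mathcal P(V_n(X))$. A *nonstandard universe* ${}^*V$ is a triple $(V(X),V(Y),{}^*)$ where $X,Y$ are infinite base sets and ${}^*:V(X)\to V(Y)$ is a map such that ${}^*X=Y$; for every bounded quantifier formula $\varphi(v_1,\dots,v_n)$ of set theory and all $a_1,\dots,a_n\in V(X)$, $V(X)\models\varphi[a_1,\dots,a_n]$ iff $V(Y)\models\varphi[{}^*a_1,\dots,{}^*a_n]$; and $\{{}^*a:a\in A\}\subsetneq{}^*A$ for every infinite $A\subseteq X$. An object $b\in V(Y)$ is *internal* if $b\in{}^*a$ for some $a\in V(X)$; an *internal set* is an internal object not in $Y$. Let $\mathcal L$ be a first-order language; $|\mathcal L|$ denotes the number of its (function, constant and relation) symbols. An $\mathcal L$-model (with nonempty base set) is *internally presented* in ${}^*V$ if its base set and its interpretation of every symbol of $\mathcal L$ are internal. For an infinite cardinal $\kappa$, ${}^*V$ has the *$\kappa$-isomorphism property* $IP_\kappa$ if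 for every $\mathcal L$ with $|\mathcal L|<\kappa$, any two elementarily equivalent internally presented $\mathcal L$-models are isomorphic. ${}^*V$ is *$\kappa$-saturated* if every family of fewer than $\kappa$ internal sets with the finite intersection property has a common element. Let $X$ be an $n$-ary predicate symbol not in $\mathcal L$. An *$n$-$\Delta^1_0(\mathcal L)$ type* is a consistent set $\Gamma(X)$ of $\mathcal L\cup\{X\}$-sentences. It is *consistent with* an $\mathcal L$-model $\mathfrak A$ if $\Gamma(X)\cup Th(\mathfrak A)$ is consistent, where $Th(\mathfrak A)$ is the set of $\mathcal L$-sentences true in $\mathfrak A$. (A set of sentences is consistent if it has a model.) $\mathfrak A$, with base set $A$, *realizes* $\Gamma(X)$ if there is $S\subseteq A^n$, not necessarily internal, with $(\mathfrak A,S)\models\Gamma(X)$. For a natural number $n$, let $R_{\kappa,n}$ be the statement: for every $\mathcal L$ with $|\mathcal L|<\kappa$, every $n$-$\Delta^1_0(\mathcal L)$ type $\Gamma(X)$ and every internally presented $\mathcal L$-model $\mathfrak A$ in ${}^*V$, if $\Gamma(X)$ is consistent with $\mathfrak A$, then $\mathfrak A$ realizes $\Gamma(X)$. **Theorem.** Let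 ${}^*V$ be a nonstandard universe and let $\kappa$ be an (infinite) regular cardinal. 1. If $\kappa<\beth_\omega$, then ${}^*V$ satisfies $IP_\kappa$ if and only if $R_{\kappa,n}$ holds for every $n$. 2. (With no upper bound on $\kappa$.) If $R_{\kappa,2}$ holds, then ${}^*V$ satisfies $IP_\kappa$. 3. If $\kappa<\beth_\omega$ and ${}^*V$ satisfies $IP_\kappa$, then ${}^*V$ is $\kappa$-saturated. -/

import Mathlib

open FirstOrder Cardinal

universe u

/-! ### Superstructures -/

/-- The levels of the superstructure over `X`: `V₀(X) = X` and `Vₙ₊₁(X) = Vₙ(X) ∪ 𝒫(Vₙ(X))`. -/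
noncomputable def superstructureLevel (X : ZFSet.{u}) : ℕ → ZFSet.{u}
  | 0 => X
  | n + 1 => superstructureLevel X n ∪ (superstructureLevel X n).powerset

/-- The superstructure `V(X) = ⋃ₙ Vₙ(X)`. -/
def superstructure (X : ZFSet.{u}) : Set ZFSet.{u} :=
  {x | ∃ n, x ∈ superstructureLevel X n}

/-- `X` is a base set: its elements are nonempty and have no members in `V(X)`, so that inside
`V(X)` they behave as atoms. -/
def IsBaseSet (X : ZFSet.{u}) : Prop :=
  ∅ ∉ X ∧ ∀ x ∈ X, ∀ y ∈ superstructure X, y ∉ x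

theorem mem_superstructure_of_subset {X A : ZFSet.{u}} (h : A ⊆ X) : A ∈ superstructure X :=
  ⟨1, ZFSet.mem_union.2 (Or.inr (ZFSet.mem_powerset.2 h))⟩

/-! ### Bounded quantifier formulas and transfer -/

/-- Formulas of the language of set theory with free variables `v₀, …, vₙ₋₁`, all of whose
quantifiers are bounded; `exMem i φ` is `∃ vₙ ∈ vᵢ, φ` and `allMem i φ` is `∀ vₙ ∈ vᵢ, φ`. -/
inductive BddFormula : ℕ → Type
  | mem {n : ℕ} (i j : Fin n) : BddFormula n
  | eq {n : ℕ} (i j : Fin n) : BddFormula n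
  | neg {n : ℕ} (φ : BddFormula n) : BddFormula n
  | and {n : ℕ} (φ ψ : BddFormula n) : BddFormula n
  | or {n : ℕ} (φ ψ : BddFormula n) : BddFormula n
  | exMem {n : ℕ} (i : Fin n) (φ : BddFormula (n + 1)) : BddFormula n
  | allMem {n : ℕ} (i : Fin n) (φ : BddFormula (n + 1)) : BddFormula n

/-- Satisfaction of a bounded quantifier formula in the structure `(M, ∈)`. -/
def BddFormula.Holds (M : Set ZFSet.{u}) : {n : ℕ} → BddFormula n → (Fin n → M) → Prop
  | _, .mem i j, v => (v i : ZFSet.{u}) ∈ (v j : ZFSet.{u})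
  | _, .eq i j, v => v i = v j
  | _, .neg φ, v => ¬ φ.Holds M v
  | _, .and φ ψ, v => φ.Holds M v ∧ ψ.Holds M v
  | _, .or φ ψ, v => φ.Holds M v ∨ ψ.Holds M v
  | _, .exMem i φ, v =>
      ∃ y : M, (y : ZFSet.{u}) ∈ (v i : ZFSet.{u}) ∧ φ.Holds M (Fin.snoc v y)
  | _, .allMem i φ, v =>
      ∀ y : M, (y : ZFSet.{u}) ∈ (v i : ZFSet.{u}) → φ.Holds M (Fin.snoc v y)

/-- A nonstandard universe `(V(X), V(Y), *)`. -/
structure NonstandardUniverse where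
  /-- the set of standard atoms -/
  X : ZFSet.{u}
  /-- the set of nonstandard atoms -/
  Y : ZFSet.{u}
  isBaseSet_X : IsBaseSet X
  isBaseSet_Y : IsBaseSet Y
  infinite_X : {x : ZFSet.{u} | x ∈ X}.Infinite
  infinite_Y : {y : ZFSet.{u} | y ∈ Y}.Infinite
  /-- the embedding `*` of the standard universe -/
  star : superstructure X → superstructure Y
  star_base : (star ⟨X, mem_superstructure_of_subset fun _ h => h⟩ : ZFSet.{u}) = Y
  /-- the transfer principle -/
  transfer : ∀ {n : ℕ} (φ : BddFormula n) (a : Fin n → superstructure X),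
    φ.Holds (superstructure X) a ↔ φ.Holds (superstructure Y) (fun i => star (a i))
  /-- every infinite set `A` of standard atoms satisfies `{*a : a ∈ A} ≠ *A` -/
  proper : ∀ (A : ZFSet.{u}) (hA : A ⊆ X), {x : ZFSet.{u} | x ∈ A}.Infinite →
    ∃ y ∈ (star ⟨A, mem_superstructure_of_subset hA⟩ : ZFSet.{u}),
      ∀ a : superstructure X, (a : ZFSet.{u}) ∈ A → (star a : ZFSet.{u}) ≠ y

/-! ### Internally presented models -/

/-- Set-theoretic tuples: `(a) = a` and `(a₁, …, aₙ₊₁) = ((a₁, …, aₙ), aₙ₊₁)` with Kuratowski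
pairs; the empty tuple is `∅`. -/
def zfTuple : {n : ℕ} → (Fin n → ZFSet.{u}) → ZFSet.{u}
  | 0, _ => ∅
  | 1, a => a 0
  | n + 2, a => ZFSet.pair (zfTuple (n := n + 1) (Fin.init a)) (a (Fin.last (n + 1)))

/-- The type of elements of a set; it is the carrier of a model with base set `A`. -/
abbrev ZFElem (A : ZFSet.{u}) : Type (u + 1) := {x : ZFSet.{u} // x ∈ A}

/-- `R`, as a set of tuples, is the relation `r` on `A`. -/
def CodesRel (A : ZFSet.{u}) {n : ℕ} (r : Set (Fin n → ZFElem A)) (R : ZFSet.{u}) : Prop :=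
  ∀ z, z ∈ R ↔ ∃ v ∈ r, z = zfTuple fun i => (v i : ZFSet.{u})

/-- The graph of an `n`-ary function as an `(n + 1)`-ary relation. -/
def graphRel {M : Type*} {n : ℕ} (f : (Fin n → M) → M) : Set (Fin (n + 1) → M) :=
  {w | w (Fin.last n) = f (Fin.init w)}

namespace NonstandardUniverse

variable (U : NonstandardUniverse.{u})

/-- `b ∈ V(Y)` is internal if `b ∈ *a` for some `a ∈ V(X)`. -/
def IsInternal (b : ZFSet.{u}) : Prop :=
  b ∈ superstructure U.Y ∧ ∃ a : superstructure U.X, b ∈ (U.star a : ZFSet.{u})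

/-- An internal set is an internal object that is not an atom. -/
def IsInternalSet (b : ZFSet.{u}) : Prop :=
  U.IsInternal b ∧ b ∉ U.Y

/-- The `L`-model with base set `A` is internally presented: the (nonempty) base set and the
interpretations of all symbols of `L` (functions being sets of tuples) are internal. -/
def InternallyPresented (L : FirstOrder.Language.{u, u}) (A : ZFSet.{u}) [L.Structure (ZFElem A)] : Prop :=
  U.IsInternalSet A ∧ A.Nonempty ∧
  (∀ (n : ℕ) (f : L.Functions n), ∃ F, U.IsInternalSet F ∧
    CodesRel A (graphRel fun v : Fin n → ZFElem A => FirstOrder.Language.Structure.funMap f v) F) ∧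
  (∀ (n : ℕ) (r : L.Relations n), ∃ R, U.IsInternalSet R ∧
    CodesRel A {v : Fin n → ZFElem A | FirstOrder.Language.Structure.RelMap r v} R)

/-- The `κ`-isomorphism property. -/
def IsomorphismProperty (κ : Cardinal.{u}) : Prop :=
  ∀ L : FirstOrder.Language.{u, u}, L.card < κ →
    ∀ (A B : ZFSet.{u}) [L.Structure (ZFElem A)] [L.Structure (ZFElem B)],
      U.InternallyPresented L A → U.InternallyPresented L B →
      L.ElementarilyEquivalent (ZFElem A) (ZFElem B) →
      Nonempty (L.Equiv (ZFElem A) (ZFElem B))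

/-- `κ`-saturation: fewer than `κ` internal sets with the finite intersection property have a
common element. -/
def Saturated (κ : Cardinal.{u}) : Prop :=
  ∀ (I : Type u) (F : I → ZFSet.{u}), #I < κ → (∀ i, U.IsInternalSet (F i)) →
    (∀ s : Finset I, ∃ x, ∀ i ∈ s, x ∈ F i) → ∃ x, ∀ i, x ∈ F i

end NonstandardUniverse

/-! ### Types in a new predicate -/

/-- The only symbol of the language `{X}`, a relation symbol of arity `n`. -/
inductive NewPred (n : ℕ) : ℕ → Type
  | X : NewPred n n

/-- The language `{X}` with one `n`-ary predicate symbol. -/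
def newPredLang (n : ℕ) : FirstOrder.Language.{0, 0} where
  Functions := fun _ => Empty
  Relations := NewPred n

/-- The interpretation of `X` by a set `S` of `n`-tuples. -/
@[reducible]
def newPredStructure {M : Type*} {n : ℕ} (S : Set (Fin n → M)) : (newPredLang n).Structure M where
  funMap := fun f _ => f.elim
  RelMap := fun r => match r with
    | NewPred.X => fun v => v ∈ S

/-- The language `L ∪ {X}`. -/
abbrev withPred (L : FirstOrder.Language.{u, u}) (n : ℕ) : FirstOrder.Language.{u, u} := L.sum (newPredLang n)

/-- An `n`-`Δ¹₀(L)` type is a consistent set of `L ∪ {X}`-sentences. -/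
def IsDeltaType {L : FirstOrder.Language.{u, u}} {n : ℕ} (Γ : (withPred L n).Theory) : Prop :=
  Γ.IsSatisfiable

/-- `Γ(X)` is consistent with the model `M`: `Γ(X) ∪ Th(M)` is consistent. -/
def ConsistentWith {L : FirstOrder.Language.{u, u}} {n : ℕ} (Γ : (withPred L n).Theory)
    (M : Type*) [L.Structure M] : Prop :=
  FirstOrder.Language.Theory.IsSatisfiable
    (Γ ∪ (FirstOrder.Language.LHom.sumInl : L →ᴸ withPred L n).onTheory (L.completeTheory M))

/-- `M` realizes `Γ(X)`: some expansion `(M, S)` is a model of `Γ(X)`. -/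
def RealizesType {L : FirstOrder.Language.{u, u}} {n : ℕ} (Γ : (withPred L n).Theory)
    (M : Type*) [L.Structure M] : Prop :=
  ∃ S : Set (Fin n → M),
    letI : (newPredLang n).Structure M := newPredStructure S
    FirstOrder.Language.Theory.Model M Γ

/-- Every internally presented model for a language with fewer than `κ` symbols realizes all
`n`-`Δ¹₀` types that are consistent with it. -/
def NonstandardUniverse.RealizesAllTypes (U : NonstandardUniverse.{u}) (κ : Cardinal.{u})
    (n : ℕ) : Prop :=
  ∀ L : FirstOrder.Language.{u, u}, L.card < κ → ∀ Γ : (withPred L n).Theory, IsDeltaType Γ →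
    ∀ (A : ZFSet.{u}) [L.Structure (ZFElem A)], U.InternallyPresented L A →
      ConsistentWith Γ (ZFElem A) → RealizesType Γ (ZFElem A)

/-!
The theorem rests on two constructions of internally presented structures.

*From types to isomorphisms.* Let `A ≡ B` be internally presented. Replacing `B` by the internal
copy `B × {A}`, which is disjoint from `A` by foundation, makes the disjoint sum of `A` and `B` an
internally presented structure for a relational language with a predicate for the first summand and
with the relations and graphs of both summands (`internallyPresented_union`). By the
Feferman–Vaught argument (`BoundedFormula.exists_agree_pair`) the theory of a sum depends only on
the theories of the summands, so this sum is elementarily equivalent to `A + A`, where the identity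
is an isomorphism between the summands. The complete theory of `A + A` with a binary predicate for
this isomorphism is therefore consistent with the sum of `A` and `B`, and a realization of it is an
isomorphism of `A` and `B`. No bound on `κ` is used.

*From isomorphisms to types.* Let `Γ` be consistent with the internally presented `A`. If
`κ < ℶ_ω`, then `Γ ∪ Th(A)` has a model of size at most some `ℶ_m`, and since the levels of `V(X)`
reach these cardinalities, there is such a model coded in `V(X)` (`exists_isCoded`). Its nonstandard
extension is internally presented and, by transfer, still a model of `Γ ∪ Th(A)`
(`exists_star_model`). The isomorphism property makes its `L`-reduct isomorphic to `A`, and the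
isomorphism carries the interpretation of the new predicate over to `A`.

Saturation follows from the case of a unary predicate: a nonempty set contained in all the given
internal sets is described by a type that is consistent by compactness.

Transfer is organized by the notion `IsBounded`, a semantic form of definability by bounded
quantifier formulas that is closed under connectives, bounded quantifiers and quantification over
tuples. It gives the internal definition principle (`exists_internal_sep`), and it covers
satisfaction of first-order formulas in coded structures (`BoundedFormula.exists_isBounded`).
-/

universe w

/-! ### Superstructures over base sets -/

theorem superstructureLevel_mono {X : ZFSet.{u}} : Monotone (superstructureLevel X) :=
  monotone_nat_of_le_succ fun _ _ hx => ZFSet.mem_union.2 (Or.inl hx)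

theorem superstructureLevel_subset {X : ZFSet.{u}} {m n : ℕ} (h : m ≤ n) {x : ZFSet.{u}}
    (hx : x ∈ superstructureLevel X m) : x ∈ superstructureLevel X n :=
  superstructureLevel_mono h hx

theorem mem_superstructureLevel_succ {X x : ZFSet.{u}} {n : ℕ} :
    x ∈ superstructureLevel X (n + 1) ↔
      x ∈ superstructureLevel X n ∨ x ⊆ superstructureLevel X n := by
  simp [superstructureLevel]

theorem mem_or_subset_of_mem_level {X x : ZFSet.{u}} {n : ℕ}
    (hx : x ∈ superstructureLevel X n) : x ∈ X ∨ x ⊆ superstructureLevel X n := by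
  induction n with
  | zero => exact Or.inl hx
  | succ n ih =>
    rcases mem_superstructureLevel_succ.1 hx with h | h
    · exact (ih h).imp_right fun h' y hy => superstructureLevel_subset n.le_succ (h' hy)
    · exact Or.inr fun y hy => superstructureLevel_subset n.le_succ (h hy)

theorem superstructureLevel_mem {X : ZFSet.{u}} (n : ℕ) :
    superstructureLevel X n ∈ superstructureLevel X (n + 1) :=
  mem_superstructureLevel_succ.2 (Or.inr fun _ h => h)

namespace IsBaseSet

variable {X : ZFSet.{u}}

theorem subset_level (_ : IsBaseSet X) {x : ZFSet.{u}} {n : ℕ}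
    (hx : x ∈ superstructureLevel X n) (h : x ∉ X) :
    x ⊆ superstructureLevel X n :=
  (mem_or_subset_of_mem_level hx).resolve_left h

theorem mem_superstructure_of_mem (hX : IsBaseSet X) {x y : ZFSet.{u}}
    (hx : x ∈ superstructure X) (h : x ∉ X)
    (hy : y ∈ x) : y ∈ superstructure X := by
  obtain ⟨n, hn⟩ := hx
  exact ⟨n, hX.subset_level hn h hy⟩

/-- A member inside the superstructure of an element of the `n`-th level is in the `n`-th level. -/
theorem mem_level_of_mem (hX : IsBaseSet X) {x y : ZFSet.{u}} {n : ℕ}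
    (hx : x ∈ superstructureLevel X n) (hy : y ∈ superstructure X) (hyx : y ∈ x) :
    y ∈ superstructureLevel X n :=
  hX.subset_level hx (fun h => hX.2 x h y hy hyx) hyx

/-- A set of elements of a level is not an atom. -/
theorem notMem_of_subset_level (hX : IsBaseSet X) {x : ZFSet.{u}} {n : ℕ}
    (hx : x ⊆ superstructureLevel X n) :
    x ∉ X := by
  intro h
  rcases ZFSet.eq_empty_or_nonempty x with rfl | ⟨y, hy⟩
  · exact hX.1 h
  · exact hX.2 x h y ⟨n, hx hy⟩ hy

theorem notMem_of_mem (hX : IsBaseSet X) {x y : ZFSet.{u}}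
    (hy : y ∈ superstructure X) (hyx : y ∈ x) : x ∉ X :=
  fun h => hX.2 x h y hy hyx

end IsBaseSet

theorem pair_mem_superstructureLevel {X x y : ZFSet.{u}} {n : ℕ}
    (hx : x ∈ superstructureLevel X n) (hy : y ∈ superstructureLevel X n) :
    ZFSet.pair x y ∈ superstructureLevel X (n + 2) := by
  refine mem_superstructureLevel_succ.2 (Or.inr fun z hz => ?_)
  refine mem_superstructureLevel_succ.2 (Or.inr fun w hw => ?_)
  rcases ZFSet.mem_pair.1 (show z ∈ ({{x}, {x, y}} : ZFSet) from hz) with rfl | rfl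
  · rw [ZFSet.mem_singleton.1 hw]; exact hx
  · rcases ZFSet.mem_pair.1 hw with rfl | rfl <;> assumption

theorem zfTuple_mem_superstructureLevel {X : ZFSet.{u}} {m : ℕ} :
    ∀ {n : ℕ} (a : Fin n → ZFSet.{u}), (∀ i, a i ∈ superstructureLevel X m) →
      zfTuple a ∈ superstructureLevel X (m + 2 * n + 1)
  | 0, _, _ => mem_superstructureLevel_succ.2 (Or.inr fun _ h => (ZFSet.notMem_empty _ h).elim)
  | 1, _, h => superstructureLevel_subset (by omega) (h 0)
  | n + 2, a, h =>
    superstructureLevel_subset (m := m + 2 * (n + 1) + 1 + 2) (by omega)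
      (pair_mem_superstructureLevel (zfTuple_mem_superstructureLevel (n := n + 1) (Fin.init a)
        fun i => h _) (superstructureLevel_subset (by omega) (h _)))

theorem zfTuple_injective : ∀ {n : ℕ}, Function.Injective (zfTuple.{u} (n := n))
  | 0, _, _, _ => Subsingleton.elim _ _
  | 1, a, b, h => funext fun i => by rw [Subsingleton.elim i 0]; exact h
  | n + 2, a, b, h => by
    obtain ⟨h1, h2⟩ := ZFSet.pair_injective h
    rw [← Fin.snoc_init_self a, ← Fin.snoc_init_self b, zfTuple_injective h1, h2]

/-! ### Predicates given by bounded quantifier formulas -/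

/-- Renaming of the variables of a bounded quantifier formula. -/
def BddFormula.rename : {n m : ℕ} → BddFormula n → (Fin n → Fin m) → BddFormula m
  | _, _, .mem i j, f => .mem (f i) (f j)
  | _, _, .eq i j, f => .eq (f i) (f j)
  | _, _, .neg φ, f => .neg (φ.rename f)
  | _, _, .and φ ψ, f => .and (φ.rename f) (ψ.rename f)
  | _, _, .or φ ψ, f => .or (φ.rename f) (ψ.rename f)
  | _, m, .exMem i φ, f =>
      .exMem (f i) (φ.rename (Fin.snoc (α := fun _ => Fin (m + 1)) (Fin.castSucc ∘ f) (Fin.last m)))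
  | _, m, .allMem i φ, f =>
      .allMem (f i)
        (φ.rename (Fin.snoc (α := fun _ => Fin (m + 1)) (Fin.castSucc ∘ f) (Fin.last m)))

theorem snoc_comp_snoc_castSucc {α : Type*} {n m : ℕ} (f : Fin n → Fin m) (v : Fin m → α) (y : α) :
    (Fin.snoc (α := fun _ => α) v y) ∘
      (Fin.snoc (α := fun _ => Fin (m + 1)) (Fin.castSucc ∘ f) (Fin.last m)) =
    Fin.snoc (α := fun _ => α) (v ∘ f) y := by
  funext i
  refine Fin.lastCases ?_ (fun i => ?_) i <;> simp

theorem BddFormula.holds_rename {M : Set ZFSet.{u}} {n : ℕ} (φ : BddFormula n) :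
    ∀ {m : ℕ} (f : Fin n → Fin m) (v : Fin m → M),
      (φ.rename f).Holds M v ↔ φ.Holds M (v ∘ f) := by
  induction φ with
  | mem i j => intros; rfl
  | eq i j => intros; rfl
  | neg φ ih => intro m f v; simp only [rename, Holds, ih]
  | and φ ψ ih1 ih2 => intro m f v; simp only [rename, Holds, ih1, ih2]
  | or φ ψ ih1 ih2 => intro m f v; simp only [rename, Holds, ih1, ih2]
  | exMem i φ ih =>
    intro m f v; simp only [rename, Holds, ih, snoc_comp_snoc_castSucc, Function.comp_apply]
  | allMem i φ ih =>
    intro m f v; simp only [rename, Holds, ih, snoc_comp_snoc_castSucc, Function.comp_apply]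

/-- The base set `X` as an element of `V(X)`. -/
def baseElem (X : ZFSet.{u}) : superstructure X :=
  ⟨X, mem_superstructure_of_subset fun _ h => h⟩

/-- A predicate on `ι`-indexed families of elements of superstructures, uniform in the base set,
is *bounded* if over base sets it is given by one bounded quantifier formula. The indices of the
variables are arbitrary, and the base set itself (`none`) may be used as a parameter. -/
def IsBounded {ι : Type*} (P : (X : ZFSet.{u}) → (ι → superstructure X) → Prop) : Prop :=
  ∃ (n : ℕ) (φ : BddFormula n) (f : Fin n → Option ι), ∀ X, IsBaseSet X →
    ∀ v : ι → superstructure X,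
      φ.Holds (superstructure X) (fun j => (f j).elim (baseElem X) v) ↔ P X v

namespace IsBounded

variable {ι : Type*} {P Q : (X : ZFSet.{u}) → (ι → superstructure X) → Prop}

theorem congr (h : IsBounded P)
    (e : ∀ X, IsBaseSet X → ∀ v : ι → superstructure X, P X v ↔ Q X v) : IsBounded Q := by
  obtain ⟨n, φ, f, hφ⟩ := h
  exact ⟨n, φ, f, fun X hX v => (hφ X hX v).trans (e X hX v)⟩

theorem mem (i j : ι) : IsBounded fun _ v => (v i : ZFSet.{u}) ∈ (v j : ZFSet.{u}) :=
  ⟨2, .mem 0 1, ![some i, some j], fun _ _ _ => Iff.rfl⟩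

theorem memBase (i : ι) : IsBounded fun X v => (v i : ZFSet.{u}) ∈ X :=
  ⟨2, .mem 0 1, ![some i, none], fun _ _ _ => Iff.rfl⟩

theorem eq (i j : ι) : IsBounded fun _ v => (v i : ZFSet.{u}) = (v j : ZFSet.{u}) :=
  ⟨2, .eq 0 1, ![some i, some j], fun _ _ _ => Subtype.ext_iff⟩

theorem not (h : IsBounded P) : IsBounded fun X v => ¬ P X v := by
  obtain ⟨n, φ, f, hφ⟩ := h
  exact ⟨n, .neg φ, f, fun X hX v => not_congr (hφ X hX v)⟩

theorem and (hP : IsBounded P) (hQ : IsBounded Q) : IsBounded fun X v => P X v ∧ Q X v := by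
  obtain ⟨n, φ, f, hφ⟩ := hP
  obtain ⟨m, ψ, g, hψ⟩ := hQ
  refine ⟨n + m, .and (φ.rename (Fin.castAdd m)) (ψ.rename (Fin.natAdd n)), Fin.append f g,
    fun X hX v => ?_⟩
  simp only [BddFormula.Holds, BddFormula.holds_rename]
  refine and_congr (Iff.trans ?_ (hφ X hX v)) (Iff.trans ?_ (hψ X hX v)) <;>
  · simp [Function.comp_def]

theorem or (hP : IsBounded P) (hQ : IsBounded Q) : IsBounded fun X v => P X v ∨ Q X v :=
  (hP.not.and hQ.not).not.congr fun _ _ _ => by tauto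

theorem imp (hP : IsBounded P) (hQ : IsBounded Q) : IsBounded fun X v => P X v → Q X v :=
  (hP.not.or hQ).congr fun _ _ _ => by tauto

theorem true : IsBounded fun (X : ZFSet.{u}) (_ : ι → superstructure X) => True :=
  ⟨1, .eq 0 0, fun _ => none, fun _ _ _ => by simp [BddFormula.Holds]⟩

theorem comap {κ : Type*} (f : ι → κ) (hP : IsBounded P) :
    IsBounded fun X (v : κ → superstructure X) => P X fun i => v (f i) := by
  obtain ⟨n, φ, g, hφ⟩ := hP
  refine ⟨n, φ, fun j => (g j).map f, fun X hX v => Iff.trans (iff_of_eq ?_) (hφ X hX _)⟩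
  congr 1
  funext j
  rcases h : g j with _ | k <;> simp [h]

/-- Bounded existential quantification; the bound variable has index `none`. -/
theorem ex {P : (X : ZFSet.{u}) → (ι → superstructure X) → superstructure X → Prop} (i : ι)
    (hP : IsBounded fun X (w : Option ι → superstructure X) =>
      P X (fun i => w (some i)) (w none)) :
    IsBounded fun X v => ∃ y : superstructure X, (y : ZFSet.{u}) ∈ (v i : ZFSet.{u}) ∧ P X v y := by
  classical
  obtain ⟨n, φ, f, hφ⟩ := hP
  refine ⟨n + 1, .exMem (Fin.last n) (φ.rename fun j =>
      if f j = some none then Fin.last (n + 1) else j.castSucc.castSucc),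
    Fin.snoc (α := fun _ => Option ι) (fun j => (f j).elim none id) (some i),
    fun X hX v => ?_⟩
  simp only [BddFormula.Holds, BddFormula.holds_rename, Fin.snoc_last, Option.elim_some]
  refine exists_congr fun y => and_congr Iff.rfl ?_
  refine Iff.trans (iff_of_eq ?_) (hφ X hX fun o => o.elim y v)
  congr 1
  funext j
  rcases h : f j with _ | _ | k <;> simp [h]

theorem all {P : (X : ZFSet.{u}) → (ι → superstructure X) → superstructure X → Prop} (i : ι)
    (hP : IsBounded fun X (w : Option ι → superstructure X) =>
      P X (fun i => w (some i)) (w none)) :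
    IsBounded fun X v => ∀ y : superstructure X, (y : ZFSet.{u}) ∈ (v i : ZFSet.{u}) → P X v y :=
  (IsBounded.ex (P := fun X v y => ¬ P X v y) i hP.not).not.congr fun _ _ _ => by push Not; rfl

theorem forallFin {k : ℕ} {P : Fin k → (X : ZFSet.{u}) → (ι → superstructure X) → Prop}
    (h : ∀ j, IsBounded (P j)) : IsBounded fun X v => ∀ j, P j X v := by
  induction k with
  | zero => exact IsBounded.true.congr fun _ _ _ => by simp
  | succ k ih =>
    exact ((h 0).and (ih fun j => h j.succ)).congr fun _ _ _ => by rw [Fin.forall_fin_succ]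

/-- Existential quantification over a tuple of elements of a set. -/
theorem exTuple {k : ℕ}
    {P : (X : ZFSet.{u}) → (ι → superstructure X) → (Fin k → superstructure X) → Prop} (i : ι)
    (hP : IsBounded fun X (w : ι ⊕ Fin k → superstructure X) =>
      P X (fun i => w (Sum.inl i)) (fun j => w (Sum.inr j))) :
    IsBounded fun X v => ∃ x : Fin k → superstructure X,
      (∀ j, (x j : ZFSet.{u}) ∈ (v i : ZFSet.{u})) ∧ P X v x := by
  induction k with
  | zero =>
    refine (hP.comap (κ := ι) (Sum.elim id Fin.elim0)).congr fun X _ v => ⟨fun h =>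
      ⟨_, fun j => j.elim0, h⟩, ?_⟩
    rintro ⟨x, -, hx⟩
    rwa [Subsingleton.elim x fun j => _] at hx
  | succ k ih =>
    refine (ih (P := fun X v x => ∃ y : superstructure X, (y : ZFSet.{u}) ∈ (v i : ZFSet.{u}) ∧
      P X v (Fin.snoc (α := fun _ => superstructure X) x y)) ?_).congr ?_
    · refine IsBounded.ex (Sum.inl i) ?_
      refine (hP.comap (Sum.elim (fun i => some (Sum.inl i))
        (Fin.snoc (α := fun _ => Option (ι ⊕ Fin k)) (fun j => some (Sum.inr j)) none))).congr
          fun X _ v => iff_of_eq ?_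
      congr 1
      funext j
      refine Fin.lastCases ?_ (fun j => ?_) j <;> simp
    · intro X _ v
      constructor
      · rintro ⟨x, hx, y, hy, h⟩
        refine ⟨_, fun j => ?_, h⟩
        refine Fin.lastCases ?_ (fun j => ?_) j <;> simp [hx, hy]
      · rintro ⟨x, hx, h⟩
        refine ⟨Fin.init x, fun j => hx _, x (Fin.last k), hx _, ?_⟩
        rwa [Fin.snoc_init_self]

theorem allTuple {k : ℕ}
    {P : (X : ZFSet.{u}) → (ι → superstructure X) → (Fin k → superstructure X) → Prop} (i : ι)
    (hP : IsBounded fun X (w : ι ⊕ Fin k → superstructure X) =>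
      P X (fun i => w (Sum.inl i)) (fun j => w (Sum.inr j))) :
    IsBounded fun X v => ∀ x : Fin k → superstructure X,
      (∀ j, (x j : ZFSet.{u}) ∈ (v i : ZFSet.{u})) → P X v x :=
  (IsBounded.exTuple (P := fun X v x => ¬ P X v x) i hP.not).not.congr
    fun _ _ _ => by push Not; rfl

theorem eqSingleton (z a : ι) :
    IsBounded fun _ v => (v z : ZFSet.{u}) = {(v a : ZFSet.{u})} := by
  refine ((IsBounded.mem a z).and (IsBounded.all (P := fun X v y => (y : ZFSet.{u}) = v a) z
    (IsBounded.eq none (some a)))).congr fun X hX v => ⟨?_, fun h => ?_⟩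
  · rintro ⟨h1, h2⟩
    ext y
    rw [ZFSet.mem_singleton]
    refine ⟨fun hy => h2 ⟨y, ?_⟩ hy, fun hy => hy ▸ h1⟩
    exact hX.mem_superstructure_of_mem (v z).2 (hX.notMem_of_mem (v a).2 h1) hy
  · refine ⟨by simp [h], fun y hy => ?_⟩
    rwa [h, ZFSet.mem_singleton] at hy

theorem eqUnordered (z a b : ι) :
    IsBounded fun _ v => (v z : ZFSet.{u}) = {(v a : ZFSet.{u}), (v b : ZFSet.{u})} := by
  refine (((IsBounded.mem a z).and (IsBounded.mem b z)).and (IsBounded.all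
    (P := fun X v y => (y : ZFSet.{u}) = v a ∨ (y : ZFSet.{u}) = v b) z
    ((IsBounded.eq none (some a)).or (IsBounded.eq none (some b))))).congr
      fun X hX v => ⟨?_, fun h => ?_⟩
  · rintro ⟨⟨h1, h1'⟩, h2⟩
    ext y
    rw [ZFSet.mem_pair]
    refine ⟨fun hy => h2 ⟨y, ?_⟩ hy, fun hy => hy.elim (fun h => h ▸ h1) (fun h => h ▸ h1')⟩
    exact hX.mem_superstructure_of_mem (v z).2 (hX.notMem_of_mem (v a).2 h1) hy
  · refine ⟨by simp [h], fun y hy => ?_⟩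
    rwa [h, ZFSet.mem_pair] at hy

theorem eqPair (z a b : ι) :
    IsBounded fun _ v => (v z : ZFSet.{u}) = ZFSet.pair (v a) (v b) := by
  refine (IsBounded.ex (P := fun X v p => ∃ q : superstructure X,
      (q : ZFSet.{u}) ∈ (v z : ZFSet.{u}) ∧ ((p : ZFSet.{u}) = {(v a : ZFSet.{u})} ∧
      (q : ZFSet.{u}) = {(v a : ZFSet.{u}), (v b : ZFSet.{u})}) ∧
      (v z : ZFSet.{u}) = {(p : ZFSet.{u}), (q : ZFSet.{u})}) z
    (IsBounded.ex (some z) (((eqSingleton (some none) (some (some a))).and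
      (eqUnordered none (some (some a)) (some (some b)))).and
      (eqUnordered (some (some z)) (some none) none)))).congr fun X hX v => ⟨?_, fun h => ?_⟩
  · rintro ⟨p, -, q, -, ⟨h1, h2⟩, h3⟩
    rw [h3, h1, h2]
    rfl
  · have hz : (v z : ZFSet.{u}) =
        {{(v a : ZFSet.{u})}, {(v a : ZFSet.{u}), (v b : ZFSet.{u})}} := h
    obtain ⟨n, ha⟩ := (v a).2
    obtain ⟨m, hb⟩ := (v b).2
    have hp : ({(v a : ZFSet.{u})} : ZFSet) ∈ superstructure X :=
      ⟨n + 1, mem_superstructureLevel_succ.2 (Or.inr fun y hy => by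
        rwa [ZFSet.mem_singleton.1 hy])⟩
    have hq : ({(v a : ZFSet.{u}), (v b : ZFSet.{u})} : ZFSet) ∈ superstructure X :=
      ⟨max n m + 1, mem_superstructureLevel_succ.2 (Or.inr fun y hy => by
        rcases ZFSet.mem_pair.1 hy with rfl | rfl
        · exact superstructureLevel_subset (le_max_left _ _) ha
        · exact superstructureLevel_subset (le_max_right _ _) hb)⟩
    exact ⟨⟨_, hp⟩, by simp [hz], ⟨_, hq⟩, by simp [hz], ⟨rfl, rfl⟩, hz⟩

/-- The base set is needed as a parameter here: inside a superstructure an atom has no elements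
either. -/
theorem eqEmpty (z : ι) : IsBounded fun _ v => (v z : ZFSet.{u}) = ∅ := by
  refine ((IsBounded.memBase z).not.and (IsBounded.all (P := fun _ _ _ => ¬ True) z
    IsBounded.true.not)).congr fun X hX v => ⟨?_, fun h => ?_⟩
  · rintro ⟨h1, h2⟩
    exact (ZFSet.eq_empty _).2 fun y hy =>
      h2 ⟨y, hX.mem_superstructure_of_mem (v z).2 h1 hy⟩ hy trivial
  · simp only [h]
    exact ⟨hX.1, fun y hy => (ZFSet.notMem_empty _ hy).elim⟩

theorem eqTuple {n : ℕ} : ∀ {ι : Type*} (z : ι) (f : Fin n → ι),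
    IsBounded fun _ v => (v z : ZFSet.{u}) = zfTuple fun j => (v (f j) : ZFSet.{u}) := by
  induction n with
  | zero => intro ι z f; exact eqEmpty z
  | succ n ih =>
    intro ι z f
    cases n with
    | zero => exact IsBounded.eq z (f 0)
    | succ n =>
      refine (IsBounded.ex (P := fun X v p => ∃ w : superstructure X,
        (w : ZFSet.{u}) ∈ (p : ZFSet.{u}) ∧
          (v z : ZFSet.{u}) = ZFSet.pair w (v (f (Fin.last _))) ∧
          (w : ZFSet.{u}) = zfTuple fun j : Fin (n + 1) => (v (f j.castSucc) : ZFSet.{u})) z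
        (IsBounded.ex none ((eqPair (some (some z)) none (some (some (f (Fin.last _))))).and
          (ih none fun j => some (some (f j.castSucc)))))).congr fun X hX v => ⟨?_, fun h => ?_⟩
      · rintro ⟨p, -, w, -, h1, h2⟩
        rw [h1, h2]
        rfl
      · have hz : (v z : ZFSet.{u}) =
          ZFSet.pair (zfTuple fun j : Fin (n + 1) => (v (f j.castSucc) : ZFSet.{u}))
            (v (f (Fin.last _))) := h
        set w := zfTuple fun j : Fin (n + 1) => (v (f j.castSucc) : ZFSet.{u}) with hw
        choose l hl using fun j : Fin (n + 1) => (v (f j.castSucc)).2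
        have hwX : w ∈ superstructure X :=
          ⟨_, zfTuple_mem_superstructureLevel (m := Finset.univ.sup l) _ fun j =>
            superstructureLevel_subset (Finset.le_sup (Finset.mem_univ j)) (hl j)⟩
        obtain ⟨m, hm⟩ := id hwX
        have hp : ({w} : ZFSet) ∈ superstructure X :=
          ⟨m + 1, mem_superstructureLevel_succ.2 (Or.inr fun y hy => by
            rwa [ZFSet.mem_singleton.1 hy])⟩
        exact ⟨⟨_, hp⟩, by simp [hz, ZFSet.pair], ⟨w, hwX⟩, by simp, hz, rfl⟩

/-- Membership of a tuple in a set. -/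
theorem tupleMem {n : ℕ} (R : ι) (f : Fin n → ι) :
    IsBounded fun _ v => (zfTuple fun j => (v (f j) : ZFSet.{u})) ∈ (v R : ZFSet.{u}) := by
  refine (IsBounded.ex (P := fun X v z => (z : ZFSet.{u}) = zfTuple fun j => (v (f j) : ZFSet.{u}))
    R (eqTuple none fun j => some (f j))).congr fun X hX v => ⟨?_, fun h => ?_⟩
  · rintro ⟨z, hz, h⟩
    rwa [← h]
  · choose l hl using fun j : Fin n => (v (f j)).2
    exact ⟨⟨_, _, zfTuple_mem_superstructureLevel (m := Finset.univ.sup l) _ fun j =>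
      superstructureLevel_subset (Finset.le_sup (Finset.mem_univ j)) (hl j)⟩, h, rfl⟩

end IsBounded

/-! ### Transfer and internal sets -/

namespace NonstandardUniverse

variable (U : NonstandardUniverse.{u})

theorem transfer_isBounded {ι : Type*} {P : (X : ZFSet.{u}) → (ι → superstructure X) → Prop}
    (h : IsBounded P) (a : ι → superstructure U.X) :
    P U.X a ↔ P U.Y fun i => U.star (a i) := by
  obtain ⟨n, φ, f, hφ⟩ := h
  rw [← hφ U.X U.isBaseSet_X, ← hφ U.Y U.isBaseSet_Y, U.transfer φ]
  refine iff_of_eq (congrArg _ (funext fun j => ?_))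
  rcases f j with _ | i
  · exact Subtype.ext U.star_base
  · rfl

theorem star_mem_star {a b : superstructure U.X} :
    (U.star a : ZFSet.{u}) ∈ (U.star b : ZFSet.{u}) ↔ (a : ZFSet.{u}) ∈ (b : ZFSet.{u}) :=
  (U.transfer_isBounded (IsBounded.mem (ι := Bool) true false) fun i => cond i a b).symm

theorem star_mem_Y {a : superstructure U.X} :
    (U.star a : ZFSet.{u}) ∈ U.Y ↔ (a : ZFSet.{u}) ∈ U.X :=
  (U.transfer_isBounded (IsBounded.memBase (ι := Unit) ()) fun _ => a).symm

theorem isInternalSet_star {a : superstructure U.X} (ha : (a : ZFSet.{u}) ∉ U.X) :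
    U.IsInternalSet (U.star a) := by
  obtain ⟨n, hn⟩ := a.2
  exact ⟨⟨(U.star a).2, ⟨_, n + 1, superstructureLevel_mem n⟩, U.star_mem_star.2 hn⟩,
    fun h => ha (U.star_mem_Y.1 h)⟩

/-- The `n`-th level `V_n(X)` as an element of `V(X)`. -/
noncomputable def level (n : ℕ) : superstructure U.X :=
  ⟨superstructureLevel U.X n, n + 1, superstructureLevel_mem n⟩

/-- The internal level `*V_n(X)`; internal objects are the elements of these levels. -/
noncomputable def starLevel (n : ℕ) : ZFSet.{u} := U.star (U.level n)

theorem starLevel_notMem (n : ℕ) : U.starLevel n ∉ U.Y := fun h =>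
  U.isBaseSet_X.notMem_of_subset_level (x := superstructureLevel U.X n) (fun _ h => h)
    (U.star_mem_Y.1 h)

theorem mem_superstructure_of_mem_starLevel {n : ℕ} {b : ZFSet.{u}} (h : b ∈ U.starLevel n) :
    b ∈ superstructure U.Y :=
  U.isBaseSet_Y.mem_superstructure_of_mem (U.star (U.level n)).2 (U.starLevel_notMem n) h

theorem isInternal_of_mem_starLevel {n : ℕ} {b : ZFSet.{u}} (h : b ∈ U.starLevel n) :
    U.IsInternal b :=
  ⟨U.mem_superstructure_of_mem_starLevel h, _, h⟩

theorem star_subset_star {a b : superstructure U.X} (h : (a : ZFSet.{u}) ⊆ b)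
    {y : ZFSet.{u}} (hy : y ∈ superstructure U.Y) (hya : y ∈ (U.star a : ZFSet.{u})) :
    y ∈ (U.star b : ZFSet.{u}) :=
  (U.transfer_isBounded (ι := Bool) (IsBounded.all
    (P := fun _ v y => (y : ZFSet.{u}) ∈ (v false : ZFSet.{u})) true
    (IsBounded.mem none (some false))) fun i => cond i a b).1 (fun _ hy => h hy) ⟨y, hy⟩ hya

theorem starLevel_subset {m n : ℕ} (h : m ≤ n) {b : ZFSet.{u}} (hb : b ∈ U.starLevel m) :
    b ∈ U.starLevel n :=
  U.star_subset_star (a := U.level m) (b := U.level n) (superstructureLevel_mono h)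
    (U.mem_superstructure_of_mem_starLevel hb) hb

theorem IsInternal.exists_mem_starLevel {U : NonstandardUniverse.{u}} {b : ZFSet.{u}}
    (h : U.IsInternal b) : ∃ n, b ∈ U.starLevel n := by
  obtain ⟨hb, a, ha⟩ := h
  obtain ⟨n, hn⟩ := a.2
  refine ⟨n, U.star_subset_star (U.isBaseSet_X.subset_level hn fun h => ?_) hb ha⟩
  exact U.isBaseSet_Y.notMem_of_mem hb ha (U.star_mem_Y.2 h)

theorem mem_starLevel_of_mem {n : ℕ} {b c : ZFSet.{u}} (hb : b ∈ U.starLevel n)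
    (hc : c ∈ superstructure U.Y) (hcb : c ∈ b) : c ∈ U.starLevel n :=
  (U.transfer_isBounded (ι := Unit) (IsBounded.all (P := fun X v x => ∀ y : superstructure X,
    (y : ZFSet.{u}) ∈ (x : ZFSet.{u}) → (y : ZFSet.{u}) ∈ (v () : ZFSet.{u})) ()
    (IsBounded.all none (IsBounded.mem none (some (some ()))))) fun _ => U.level n).1
    (fun _ hx y hyx => U.isBaseSet_X.mem_level_of_mem hx y.2 hyx)
    ⟨b, U.mem_superstructure_of_mem_starLevel hb⟩ hb ⟨c, hc⟩ hcb

theorem zfTuple_mem_starLevel {n m : ℕ} (x : Fin n → superstructure U.Y)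
    (hx : ∀ i, (x i : ZFSet.{u}) ∈ U.starLevel m) :
    (zfTuple fun i => (x i : ZFSet.{u})) ∈ U.starLevel (m + 2 * n + 1) :=
  (U.transfer_isBounded (ι := Bool) (IsBounded.allTuple
    (P := fun _ v x => (zfTuple fun i : Fin n => (x i : ZFSet.{u})) ∈ (v false : ZFSet.{u})) true
    (IsBounded.tupleMem (Sum.inl false) Sum.inr))
    fun i => cond i (U.level m) (U.level (m + 2 * n + 1))).1
    (fun _ hx => zfTuple_mem_superstructureLevel _ hx) x hx

theorem pair_mem_starLevel {m : ℕ} {x y : ZFSet.{u}} (hx : x ∈ U.starLevel m)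
    (hy : y ∈ U.starLevel m) : ZFSet.pair x y ∈ U.starLevel (m + 5) :=
  U.zfTuple_mem_starLevel (n := 2) ![⟨x, U.mem_superstructure_of_mem_starLevel hx⟩,
    ⟨y, U.mem_superstructure_of_mem_starLevel hy⟩] (by simp [Fin.forall_fin_two, hx, hy])

theorem exists_starLevel {ι : Type*} [Finite ι] {b : ι → ZFSet.{u}}
    (hb : ∀ i, U.IsInternal (b i)) : ∃ m, ∀ i, b i ∈ U.starLevel m := by
  have := Fintype.ofFinite ι
  choose l hl using fun i => (hb i).exists_mem_starLevel
  exact ⟨Finset.univ.sup l, fun i =>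
    U.starLevel_subset (Finset.le_sup (f := l) (Finset.mem_univ i)) (hl i)⟩

variable {U}

namespace IsInternalSet

variable {b : ZFSet.{u}}

theorem mem_superstructure_of_mem (hb : U.IsInternalSet b) {z : ZFSet.{u}} (hz : z ∈ b) :
    z ∈ superstructure U.Y :=
  U.isBaseSet_Y.mem_superstructure_of_mem hb.1.1 hb.2 hz

end IsInternalSet

variable (U)

/-- The internal definition principle: a subset of an internal level defined by a bounded
quantifier formula with internal parameters is internal. -/
theorem exists_internal_sep {ι : Type*} [Finite ι]
    {Q : (X : ZFSet.{u}) → (ι → superstructure X) → superstructure X → Prop}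
    (hQ : IsBounded fun X (w : Option ι → superstructure X) =>
      Q X (fun i => w (some i)) (w none))
    (b : ι → superstructure U.Y) (hb : ∀ i, U.IsInternal (b i)) (m : ℕ) :
    ∃ y, U.IsInternalSet y ∧
      ∀ z : superstructure U.Y,
        (z : ZFSet.{u}) ∈ y ↔ (z : ZFSet.{u}) ∈ U.starLevel m ∧ Q U.Y b z := by
  classical
  obtain ⟨l, hl⟩ := U.exists_starLevel hb
  obtain ⟨k, ⟨e⟩⟩ := Finite.exists_equiv_fin ι
  -- transfer: for all parameters in `V_l` the subset of `V_m` defined by them is in `V_{m+1}`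
  have key := U.transfer_isBounded (ι := Fin 3) (IsBounded.allTuple (k := k)
    (P := fun X v x => ∃ y : superstructure X, (y : ZFSet.{u}) ∈ (v 1 : ZFSet.{u}) ∧
      ((y : ZFSet.{u}) ∉ X ∧
        (∀ z : superstructure X, (z : ZFSet.{u}) ∈ (y : ZFSet.{u}) →
          (z : ZFSet.{u}) ∈ (v 2 : ZFSet.{u}) ∧ Q X (x ∘ e) z) ∧
        ∀ z : superstructure X, (z : ZFSet.{u}) ∈ (v 2 : ZFSet.{u}) →
          Q X (x ∘ e) z → (z : ZFSet.{u}) ∈ (y : ZFSet.{u}))) 0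
    (IsBounded.ex (Sum.inl 1) ((IsBounded.memBase none).not.and
      ((IsBounded.all none ((IsBounded.mem none (some (some (Sum.inl 2)))).and
          (hQ.comap fun o => o.map fun i => some (Sum.inr (e i))))).and
        (IsBounded.all (some (Sum.inl 2))
          ((hQ.comap fun o => o.map fun i => some (Sum.inr (e i))).imp
            (IsBounded.mem none (some none)))))))) ![U.level l, U.level (m + 1), U.level m]
  obtain ⟨y, hy1, hy2, hy3, hy4⟩ := key.1 (fun x hx => by
    have hy : ∀ z, z ∈ (superstructureLevel U.X m).sep (fun z => ∃ h : z ∈ superstructure U.X,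
        Q U.X (x ∘ e) ⟨z, h⟩) ↔ z ∈ superstructureLevel U.X m ∧
          ∃ h : z ∈ superstructure U.X, Q U.X (x ∘ e) ⟨z, h⟩ := fun z => ZFSet.mem_sep
    have hsub := ZFSet.sep_subset (x := superstructureLevel U.X m)
      (p := fun z => ∃ h : z ∈ superstructure U.X, Q U.X (x ∘ e) ⟨z, h⟩)
    generalize (superstructureLevel U.X m).sep (fun z => ∃ h : z ∈ superstructure U.X,
        Q U.X (x ∘ e) ⟨z, h⟩) = y at hy hsub
    have hyl : y ∈ superstructureLevel U.X (m + 1) := mem_superstructureLevel_succ.2 (Or.inr hsub)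
    exact ⟨⟨y, m + 1, hyl⟩, hyl, U.isBaseSet_X.notMem_of_subset_level hsub,
      fun z hz => ⟨((hy z).1 hz).1, ((hy z).1 hz).2.2⟩, fun z hz hQz =>
        (hy z).2 ⟨hz, z.2, hQz⟩⟩) (b ∘ e.symm) (fun j => hl _)
  simp only [Function.comp_assoc, Equiv.symm_comp_self, Function.comp_id] at hy3 hy4
  exact ⟨y, ⟨U.isInternal_of_mem_starLevel hy1, hy2⟩, fun z => ⟨hy3 z, fun h => hy4 z h.1 h.2⟩⟩

/-- A relation on an internal set that is defined by a bounded quantifier formula with internal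
parameters is coded by an internal set. -/
theorem exists_internal_codesRel {ι : Type*} [Finite ι] {n : ℕ}
    {Q : (X : ZFSet.{u}) → (ι → superstructure X) → (Fin n → superstructure X) → Prop}
    (hQ : IsBounded fun X (w : ι ⊕ Fin n → superstructure X) =>
      Q X (fun i => w (Sum.inl i)) (fun j => w (Sum.inr j)))
    (b : ι → superstructure U.Y) (hb : ∀ i, U.IsInternal (b i)) {C : ZFSet.{u}}
    (hC : U.IsInternalSet C) (r : Set (Fin n → ZFElem C))
    (h : ∀ (v : Fin n → superstructure U.Y) (hv : ∀ i, (v i : ZFSet.{u}) ∈ C),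
      (fun i => (⟨v i, hv i⟩ : ZFElem C)) ∈ r ↔ Q U.Y b v) :
    ∃ R, U.IsInternalSet R ∧ CodesRel C r R := by
  obtain ⟨m, hm⟩ := hC.1.exists_mem_starLevel
  obtain ⟨R, hR, hRmem⟩ := U.exists_internal_sep (ι := Option ι)
    (Q := fun X w z => ∃ x : Fin n → superstructure X,
      (∀ j, (x j : ZFSet.{u}) ∈ (w none : ZFSet.{u})) ∧
      ((z : ZFSet.{u}) = (zfTuple fun j => (x j : ZFSet.{u})) ∧ Q X (fun i => w (some i)) x))
    (IsBounded.exTuple (some none) ((IsBounded.eqTuple (Sum.inl none) Sum.inr).and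
      (hQ.comap (Sum.map (fun i => some (some i)) id))))
    (fun o => o.elim ⟨C, hC.1.1⟩ b) (by rintro (_ | i); exacts [hC.1, hb i]) (m + 2 * n + 1)
  refine ⟨R, hR, fun z => ⟨fun hz => ?_, ?_⟩⟩
  · obtain ⟨-, x, hx, hzx, hQx⟩ := (hRmem ⟨z, hR.mem_superstructure_of_mem hz⟩).1 hz
    exact ⟨_, (h x hx).2 hQx, hzx⟩
  · rintro ⟨v, hv, rfl⟩
    have hvY := fun i => hC.mem_superstructure_of_mem (v i).2
    have hmem := U.zfTuple_mem_starLevel (m := m) (fun i => ⟨v i, hvY i⟩)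
      (fun i => U.mem_starLevel_of_mem hm (hvY i) (v i).2)
    exact (hRmem ⟨_, U.mem_superstructure_of_mem_starLevel hmem⟩).2
      ⟨hmem, fun i => ⟨v i, hvY i⟩, fun i => (v i).2, rfl,
        (h (fun i => ⟨v i, hvY i⟩) fun i => (v i).2).1 hv⟩

variable {U}

theorem IsInternalSet.union {A B : ZFSet.{u}} (hA : U.IsInternalSet A) (hB : U.IsInternalSet B) :
    U.IsInternalSet (A ∪ B) := by
  obtain ⟨m, hm⟩ := U.exists_starLevel (ι := Bool) (b := fun i => cond i A B)
    (by rintro (_ | _); exacts [hB.1, hA.1])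
  obtain ⟨y, hy, hmem⟩ := U.exists_internal_sep (ι := Bool)
    (Q := fun _ v z => (z : ZFSet.{u}) ∈ (v true : ZFSet.{u}) ∨
      (z : ZFSet.{u}) ∈ (v false : ZFSet.{u}))
    ((IsBounded.mem none (some true)).or (IsBounded.mem none (some false)))
    (fun i => cond i ⟨A, hA.1.1⟩ ⟨B, hB.1.1⟩) (by rintro (_ | _); exacts [hB.1, hA.1]) m
  convert hy using 1
  ext z
  rw [ZFSet.mem_union]
  constructor
  · intro hz
    have hzY : z ∈ superstructure U.Y :=
      hz.elim hA.mem_superstructure_of_mem hB.mem_superstructure_of_mem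
    exact (hmem ⟨z, hzY⟩).2 ⟨hz.elim (U.mem_starLevel_of_mem (hm true) hzY)
      (U.mem_starLevel_of_mem (hm false) hzY), hz⟩
  · intro hz
    exact ((hmem ⟨z, hy.mem_superstructure_of_mem hz⟩).1 hz).2

/-- The product of an internal set with an internal singleton is internal. -/
theorem IsInternalSet.prod_singleton {A t : ZFSet.{u}} (hA : U.IsInternalSet A)
    (ht : U.IsInternal t) : U.IsInternalSet (A.prod {t}) := by
  obtain ⟨m, hm⟩ := U.exists_starLevel (ι := Bool) (b := fun i => cond i A t)
    (by rintro (_ | _); exacts [ht, hA.1])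
  obtain ⟨y, hy, hmem⟩ := U.exists_internal_sep (ι := Bool)
    (Q := fun X v z => ∃ a : superstructure X, (a : ZFSet.{u}) ∈ (v true : ZFSet.{u}) ∧
      (z : ZFSet.{u}) = ZFSet.pair a (v false))
    (IsBounded.ex (some true) (IsBounded.eqPair (some none) none (some (some false))))
    (fun i => cond i ⟨A, hA.1.1⟩ ⟨t, ht.1⟩) (by rintro (_ | _); exacts [ht, hA.1]) (m + 5)
  convert hy using 1
  ext z
  rw [ZFSet.mem_prod]
  constructor
  · rintro ⟨a, ha, t', ht', rfl⟩
    obtain rfl := ZFSet.mem_singleton.1 ht'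
    have haY := hA.mem_superstructure_of_mem ha
    have hp := U.pair_mem_starLevel (U.mem_starLevel_of_mem (hm true) haY ha) (hm false)
    exact (hmem ⟨_, U.mem_superstructure_of_mem_starLevel hp⟩).2 ⟨hp, ⟨a, haY⟩, ha, rfl⟩
  · intro hz
    obtain ⟨-, a, ha, h⟩ := (hmem ⟨z, hy.mem_superstructure_of_mem hz⟩).1 hz
    exact ⟨a, ha, t, ZFSet.mem_singleton.2 rfl, h⟩

theorem IsInternalSet.inter {A B : ZFSet.{u}} (hA : U.IsInternalSet A) (hB : U.IsInternalSet B) :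
    U.IsInternalSet (A ∩ B) := by
  obtain ⟨m, hm⟩ := hA.1.exists_mem_starLevel
  obtain ⟨y, hy, hmem⟩ := U.exists_internal_sep (ι := Bool)
    (Q := fun _ v z => (z : ZFSet.{u}) ∈ (v true : ZFSet.{u}) ∧
      (z : ZFSet.{u}) ∈ (v false : ZFSet.{u}))
    ((IsBounded.mem none (some true)).and (IsBounded.mem none (some false)))
    (fun i => cond i ⟨A, hA.1.1⟩ ⟨B, hB.1.1⟩) (by rintro (_ | _); exacts [hB.1, hA.1]) m
  convert hy using 1
  ext z
  rw [ZFSet.mem_inter]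
  constructor
  · intro hz
    have hzY := hA.mem_superstructure_of_mem hz.1
    exact (hmem ⟨z, hzY⟩).2 ⟨U.mem_starLevel_of_mem hm hzY hz.1, hz⟩
  · intro hz
    exact ((hmem ⟨z, hy.mem_superstructure_of_mem hz⟩).1 hz).2

end NonstandardUniverse

/-! ### First-order formulas in coded structures -/

theorem CodesRel.mem_iff {A R : ZFSet.{u}} {n : ℕ} {r : Set (Fin n → ZFElem A)}
    (h : CodesRel A r R) (v : Fin n → ZFElem A) :
    v ∈ r ↔ (zfTuple fun i => (v i : ZFSet.{u})) ∈ R := by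
  refine ⟨fun hv => (h _).2 ⟨v, hv, rfl⟩, fun hv => ?_⟩
  obtain ⟨w, hw, he⟩ := (h _).1 hv
  have : v = w := funext fun i => Subtype.ext (congrFun (zfTuple_injective he) i)
  rwa [this]

theorem IsBounded.tupleSnocMem {ι : Type*} {n : ℕ} (R : ι) (f : Fin n → ι) (y : ι) :
    IsBounded fun (X : ZFSet.{u}) (v : ι → superstructure X) =>
      (zfTuple fun j : Fin (n + 1) =>
        ((Fin.snoc (α := fun _ => superstructure X) (fun j => v (f j)) (v y) j :
          superstructure X) : ZFSet.{u})) ∈ (v R : ZFSet.{u}) := by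
  refine (IsBounded.tupleMem R (Fin.snoc (α := fun _ => ι) f y)).congr fun X _ v => ?_
  refine iff_of_eq (congrArg (fun a => zfTuple a ∈ (v R : ZFSet.{u})) (funext fun j => ?_))
  refine Fin.lastCases ?_ (fun j => ?_) j <;> simp

/-- The elements of a set in `V(X)` as elements of `V(X)`. -/
def IsBaseSet.incl {X D : ZFSet.{u}} (hX : IsBaseSet X) (hD : D ∈ superstructure X) (hDX : D ∉ X)
    (a : ZFElem D) : superstructure X :=
  ⟨a, hX.mem_superstructure_of_mem hD hDX a.2⟩

theorem IsBaseSet.exists_tuple_iff {X D : ZFSet.{u}} (hX : IsBaseSet X)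
    (hD : D ∈ superstructure X) (hDX : D ∉ X) {k : ℕ}
    {P : (Fin k → superstructure X) → Prop} :
    (∃ x : Fin k → superstructure X, (∀ j, (x j : ZFSet.{u}) ∈ D) ∧ P x) ↔
      ∃ x : Fin k → ZFElem D, P fun j => hX.incl hD hDX (x j) :=
  ⟨fun ⟨x, hx, h⟩ => ⟨fun j => ⟨x j, hx j⟩, h⟩, fun ⟨x, h⟩ => ⟨_, fun j => (x j).2, h⟩⟩

theorem IsBaseSet.exists_mem_iff {X D : ZFSet.{u}} (hX : IsBaseSet X)
    (hD : D ∈ superstructure X) (hDX : D ∉ X) {P : superstructure X → Prop} :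
    (∃ x : superstructure X, (x : ZFSet.{u}) ∈ D ∧ P x) ↔
      ∃ x : ZFElem D, P (hX.incl hD hDX x) :=
  ⟨fun ⟨x, hx, h⟩ => ⟨⟨x, hx⟩, h⟩, fun ⟨x, h⟩ => ⟨_, x.2, h⟩⟩

theorem IsBaseSet.forall_mem_iff {X D : ZFSet.{u}} (hX : IsBaseSet X)
    (hD : D ∈ superstructure X) (hDX : D ∉ X) {P : superstructure X → Prop} :
    (∀ x : superstructure X, (x : ZFSet.{u}) ∈ D → P x) ↔
      ∀ x : ZFElem D, P (hX.incl hD hDX x) :=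
  ⟨fun h x => h _ x.2, fun h x hx => h ⟨x, hx⟩⟩

namespace FirstOrder.Language

variable (L : FirstOrder.Language.{u, u})

/-- The indices of the sets that make up a coded `L`-structure: `none` stands for the base set,
the others for the interpretations of the symbols. -/
abbrev CodeIndex : Type u := Option ((Σ n, L.Functions n) ⊕ (Σ n, L.Relations n))

variable {L}

/-- The family `c` of elements of `V(X)` codes the `L`-structure on the set `c none`. -/
structure IsCoded (X : ZFSet.{u}) (c : L.CodeIndex → superstructure X)
    [L.Structure (ZFElem (c none : ZFSet.{u}))] : Prop where
  notMem : (c none : ZFSet.{u}) ∉ X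
  functions : ∀ (n : ℕ) (f : L.Functions n),
    CodesRel (c none)
      (_root_.graphRel fun v : Fin n → ZFElem (c none : ZFSet.{u}) => Structure.funMap f v)
      (c (some (Sum.inl ⟨n, f⟩)))
  relations : ∀ (n : ℕ) (r : L.Relations n),
    CodesRel (c none) {v : Fin n → ZFElem (c none : ZFSet.{u}) | Structure.RelMap r v}
      (c (some (Sum.inr ⟨n, r⟩)))

theorem IsCoded.funMap_eq_iff {X : ZFSet.{u}} {c : L.CodeIndex → superstructure X}
    [L.Structure (ZFElem (c none : ZFSet.{u}))] (hX : IsBaseSet X) (hc : IsCoded X c) {n : ℕ}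
    (f : L.Functions n) (x : Fin n → ZFElem (c none : ZFSet.{u}))
    (y : ZFElem (c none : ZFSet.{u})) :
    Structure.funMap f x = y ↔ (zfTuple fun j : Fin (n + 1) =>
        ((Fin.snoc (α := fun _ => superstructure X) (fun j => hX.incl (c none).2 hc.notMem (x j))
          (hX.incl (c none).2 hc.notMem y) j : superstructure X) : ZFSet.{u})) ∈
          (c (some (Sum.inl ⟨n, f⟩)) : ZFSet.{u}) := by
  have h := (hc.functions n f).mem_iff (Fin.snoc (α := fun _ => ZFElem (c none : ZFSet.{u})) x y)
  simp only [_root_.graphRel, Set.mem_ofPred_eq, Fin.snoc_last, Fin.init_snoc] at h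
  rw [eq_comm, h]
  refine iff_of_eq (congrArg (fun a => zfTuple a ∈ _) (funext fun j => ?_))
  refine Fin.lastCases ?_ (fun j => ?_) j <;> simp [IsBaseSet.incl]

/-- The graph of a term is given by a bounded quantifier formula, uniformly in the coded
structure. -/
theorem Term.exists_isBounded {n : ℕ} (t : L.Term (Empty ⊕ Fin n)) :
    ∃ P : (X : ZFSet.{u}) → (L.CodeIndex ⊕ Fin n → superstructure X) → superstructure X → Prop,
      (IsBounded fun X (w : Option (L.CodeIndex ⊕ Fin n) → superstructure X) =>
        P X (fun i => w (some i)) (w none)) ∧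
      ∀ (X : ZFSet.{u}) (hX : IsBaseSet X) (c : L.CodeIndex → superstructure X)
        [L.Structure (ZFElem (c none : ZFSet.{u}))] (hc : IsCoded X c)
        (x : Fin n → ZFElem (c none : ZFSet.{u})) (y : ZFElem (c none : ZFSet.{u})),
        t.realize (Sum.elim default x) = y ↔
          P X (Sum.elim c fun i => hX.incl (c none).2 hc.notMem (x i))
            (hX.incl (c none).2 hc.notMem y) := by
  induction t with
  | var i =>
    rcases i with i | i
    · exact i.elim
    · refine ⟨fun X v y => (v (Sum.inr i) : ZFSet.{u}) = y, IsBounded.eq (some _) none, ?_⟩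
      intro X hX c _ hc x y
      exact Subtype.ext_iff
  | @func k f ts ih =>
    choose P hP hPr using ih
    refine ⟨fun X v y => ∃ x : Fin k → superstructure X,
      (∀ j, (x j : ZFSet.{u}) ∈ (v (Sum.inl none) : ZFSet.{u})) ∧ ((∀ j, P j X v (x j)) ∧
      (zfTuple fun j : Fin (k + 1) => ((Fin.snoc (α := fun _ => superstructure X) x y j :
          superstructure X) : ZFSet.{u})) ∈ (v (Sum.inl (some (Sum.inl ⟨k, f⟩))) : ZFSet.{u})),
      IsBounded.exTuple (some (Sum.inl none)) ((IsBounded.forallFin fun j => (hP j).comap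
        fun o => o.elim (Sum.inr j) fun i => Sum.inl (some i)).and
        (IsBounded.tupleSnocMem (Sum.inl (some (Sum.inl (some (Sum.inl ⟨k, f⟩))))) Sum.inr
          (Sum.inl none))), ?_⟩
    intro X hX c _ hc x y
    simp only [Sum.elim_inl]
    rw [hX.exists_tuple_iff (c none).2 hc.notMem]
    simp only [← hPr _ X hX c hc, ← hc.funMap_eq_iff hX]
    constructor
    · intro h
      exact ⟨fun j => (ts j).realize (Sum.elim default x), fun j => rfl, h⟩
    · rintro ⟨z, hz, h⟩
      rw [← h]
      exact congrArg _ (funext hz)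

/-- Satisfaction of a first-order formula is given by a bounded quantifier formula, uniformly in
the coded structure. -/
theorem BoundedFormula.exists_isBounded {n : ℕ} (φ : L.BoundedFormula Empty n) :
    ∃ P : (X : ZFSet.{u}) → (L.CodeIndex ⊕ Fin n → superstructure X) → Prop, IsBounded P ∧
      ∀ (X : ZFSet.{u}) (hX : IsBaseSet X) (c : L.CodeIndex → superstructure X)
        [L.Structure (ZFElem (c none : ZFSet.{u}))] (hc : IsCoded X c)
        (x : Fin n → ZFElem (c none : ZFSet.{u})),
        φ.Realize default x ↔
          P X (Sum.elim c fun i => hX.incl (c none).2 hc.notMem (x i)) := by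
  induction φ with
  | falsum => exact ⟨_, IsBounded.true.not, fun X hX c _ hc x => by simp [Realize]⟩
  | equal t₁ t₂ =>
    obtain ⟨P, hP, hPr⟩ := t₁.exists_isBounded
    obtain ⟨Q, hQ, hQr⟩ := t₂.exists_isBounded
    refine ⟨fun X v => ∃ y : superstructure X,
      (y : ZFSet.{u}) ∈ (v (Sum.inl none) : ZFSet.{u}) ∧ (P X v y ∧ Q X v y),
      IsBounded.ex _ (hP.and hQ), fun X hX c _ hc x => ?_⟩
    simp only [Sum.elim_inl]
    rw [hX.exists_mem_iff (c none).2 hc.notMem]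
    simp only [← hPr X hX c hc, ← hQr X hX c hc, Realize]
    exact ⟨fun h => ⟨_, h, rfl⟩, fun ⟨y, h1, h2⟩ => h1.trans h2.symm⟩
  | @rel n k R ts =>
    choose P hP hPr using fun j => (ts j).exists_isBounded
    refine ⟨fun X v => ∃ x : Fin k → superstructure X,
      (∀ j, (x j : ZFSet.{u}) ∈ (v (Sum.inl none) : ZFSet.{u})) ∧ ((∀ j, P j X v (x j)) ∧
      (zfTuple fun j => (x j : ZFSet.{u})) ∈ (v (Sum.inl (some (Sum.inr ⟨k, R⟩))) : ZFSet.{u})),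
      IsBounded.exTuple (Sum.inl none) ((IsBounded.forallFin fun j => (hP j).comap
        fun o => o.elim (Sum.inr j) fun i => Sum.inl i).and
        (IsBounded.tupleMem _ Sum.inr)), fun X hX c _ hc x => ?_⟩
    simp only [Sum.elim_inl]
    rw [hX.exists_tuple_iff (c none).2 hc.notMem]
    simp only [← hPr _ X hX c hc, Realize]
    have hR := fun v => (hc.relations k R).mem_iff v
    simp only [Set.mem_ofPred_eq] at hR
    simp only [hR, IsBaseSet.incl]
    constructor
    · intro h
      exact ⟨_, fun j => rfl, h⟩
    · rintro ⟨z, hz, h⟩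
      simp only [hz]
      exact h
  | imp φ ψ ih1 ih2 =>
    obtain ⟨P, hP, hPr⟩ := ih1
    obtain ⟨Q, hQ, hQr⟩ := ih2
    exact ⟨_, hP.imp hQ, fun X hX c _ hc x => imp_congr (hPr X hX c hc x) (hQr X hX c hc x)⟩
  | @all n φ ih =>
    obtain ⟨P, hP, hPr⟩ := ih
    refine ⟨fun X v => ∀ y : superstructure X, (y : ZFSet.{u}) ∈ (v (Sum.inl none) : ZFSet.{u}) →
      P X (Sum.elim (fun i => v (Sum.inl i))
        (Fin.snoc (α := fun _ => superstructure X) (fun i => v (Sum.inr i)) y)),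
      IsBounded.all (Sum.inl none) ((hP.comap (Sum.elim (fun i => some (Sum.inl i))
        (Fin.snoc (α := fun _ => Option (L.CodeIndex ⊕ Fin n))
          (fun i => some (Sum.inr i)) none))).congr ?_), fun X hX c _ hc x => ?_⟩
    · intro X _ v
      refine iff_of_eq (congrArg _ (funext fun i => ?_))
      rcases i with i | i
      · rfl
      · refine Fin.lastCases ?_ (fun i => ?_) i <;> simp
    · simp only [Sum.elim_inl, Sum.elim_inr]
      rw [hX.forall_mem_iff (c none).2 hc.notMem]
      simp only [Realize, hPr X hX c hc]
      refine forall_congr' fun y => iff_of_eq (congrArg _ (congrArg _ (funext fun i => ?_)))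
      refine Fin.lastCases ?_ (fun i => ?_) i <;> simp

end FirstOrder.Language

theorem IsBaseSet.notMem_of_codesRel {X A R : ZFSet.{u}} (hX : IsBaseSet X)
    (hA : A ∈ superstructure X) (hAX : A ∉ X) {n : ℕ} {r : Set (Fin n → ZFElem A)}
    (h : CodesRel A r R) : R ∉ X := by
  intro hR
  rcases ZFSet.eq_empty_or_nonempty R with rfl | ⟨z, hz⟩
  · exact hX.1 hR
  · obtain ⟨v, -, rfl⟩ := (h z).1 hz
    obtain ⟨m, hm⟩ := hA
    exact hX.2 R hR _ ⟨_, zfTuple_mem_superstructureLevel _ fun i =>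
      hX.subset_level hm hAX (v i).2⟩ hz

namespace NonstandardUniverse

variable (U : NonstandardUniverse.{u})

/-- The nonstandard extension of a structure coded in `V(X)` is internally presented and, by
transfer, elementarily equivalent to the structure. -/
theorem exists_star_model {L : FirstOrder.Language.{u, u}}
    (c : L.CodeIndex → superstructure U.X) [L.Structure (ZFElem (c none : ZFSet.{u}))]
    (hc : L.IsCoded U.X c) (hne : (c none : ZFSet.{u}).Nonempty) :
    ∃ _ : L.Structure (ZFElem (U.star (c none) : ZFSet.{u})),
      U.InternallyPresented L (U.star (c none)) ∧
      L.ElementarilyEquivalent (ZFElem (c none : ZFSet.{u}))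
        (ZFElem (U.star (c none) : ZFSet.{u})) := by
  have hX := U.isBaseSet_X
  have hY := U.isBaseSet_Y
  have hD' : (U.star (c none) : ZFSet.{u}) ∉ U.Y := fun h => hc.notMem (U.star_mem_Y.1 h)
  have hDmem : ∀ a : ZFElem (U.star (c none) : ZFSet.{u}), (a : ZFSet.{u}) ∈ superstructure U.Y :=
    fun a => hY.mem_superstructure_of_mem (U.star (c none)).2 hD' a.2
  -- an `n`-ary code contains only tuples of elements of the base set
  have sub : ∀ {n : ℕ} (i : L.CodeIndex), (∃ r, CodesRel (c none) (n := n) r (c i)) →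
      ∀ z ∈ (U.star (c i) : ZFSet.{u}), ∃ v : Fin n → ZFElem (U.star (c none) : ZFSet.{u}),
        z = zfTuple fun j => (v j : ZFSet.{u}) := by
    rintro n i ⟨r, hr⟩ z hz
    have hi : (U.star (c i) : ZFSet.{u}) ∉ U.Y := fun h =>
      hX.notMem_of_codesRel (c none).2 hc.notMem hr (U.star_mem_Y.1 h)
    obtain ⟨x, hx, h⟩ := (U.transfer_isBounded (IsBounded.all i (P := fun X v z =>
      ∃ x : Fin n → superstructure X, (∀ j, (x j : ZFSet.{u}) ∈ (v none : ZFSet.{u})) ∧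
        (z : ZFSet.{u}) = zfTuple fun j => (x j : ZFSet.{u}))
      (IsBounded.exTuple (some none) (IsBounded.eqTuple (Sum.inl none) Sum.inr))) c).1
      (fun z hz => by
        obtain ⟨v, -, h⟩ := (hr _).1 hz
        exact ⟨fun j => hX.incl (c none).2 hc.notMem (v j), fun j => (v j).2, h⟩)
      ⟨z, hY.mem_superstructure_of_mem (U.star (c i)).2 hi hz⟩ hz
    exact ⟨fun j => ⟨x j, hx j⟩, h⟩
  have snocMem : ∀ {X A F : ZFSet.{u}} {n : ℕ}
      (hmem : ∀ a : ZFElem A, (a : ZFSet.{u}) ∈ superstructure X)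
      (v : Fin n → ZFElem A) (y : ZFElem A),
      (zfTuple fun j : Fin (n + 1) => ((Fin.snoc (α := fun _ => superstructure X)
        (fun j => ⟨v j, hmem _⟩) ⟨y, hmem _⟩ j : superstructure X) : ZFSet.{u})) ∈ F ↔
      (zfTuple fun j : Fin (n + 1) =>
        ((Fin.snoc (α := fun _ => ZFElem A) v y j : ZFElem A) : ZFSet.{u})) ∈ F := by
    intro X A F n hmem v y
    refine iff_of_eq (congrArg (fun a => zfTuple a ∈ F) (funext fun j => ?_))
    refine Fin.lastCases ?_ (fun j => ?_) j <;> simp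
  -- the starred graph of a function symbol is the graph of a total function
  have total : ∀ (n : ℕ) (f : L.Functions n) (v : Fin n → ZFElem (U.star (c none) : ZFSet.{u})),
      ∃ y : ZFElem (U.star (c none) : ZFSet.{u}),
        (zfTuple fun j : Fin (n + 1) =>
          ((Fin.snoc (α := fun _ => ZFElem (U.star (c none) : ZFSet.{u})) v y j :
              ZFElem (U.star (c none) : ZFSet.{u})) : ZFSet.{u})) ∈
            (U.star (c (some (Sum.inl ⟨n, f⟩))) : ZFSet.{u}) := by
    intro n f v
    obtain ⟨y, hy, h⟩ := (U.transfer_isBounded (IsBounded.allTuple none (P := fun X v x =>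
      ∃ y : superstructure X, (y : ZFSet.{u}) ∈ (v none : ZFSet.{u}) ∧
        (zfTuple fun j : Fin (n + 1) => ((Fin.snoc (α := fun _ => superstructure X) x y j :
          superstructure X) : ZFSet.{u})) ∈ (v (some (Sum.inl ⟨n, f⟩)) : ZFSet.{u}))
      (IsBounded.ex (Sum.inl none) (IsBounded.tupleSnocMem (ι := Option (L.CodeIndex ⊕ Fin n))
        (some (Sum.inl (some (Sum.inl ⟨n, f⟩))))
        (fun j => some (Sum.inr j)) none))) c).1
      (fun x hx => ⟨hX.incl (c none).2 hc.notMem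
          (FirstOrder.Language.Structure.funMap f fun j => ⟨x j, hx j⟩),
        (FirstOrder.Language.Structure.funMap f fun j => (⟨x j, hx j⟩ : ZFElem _)).2,
        (hc.funMap_eq_iff hX f (fun j => ⟨x j, hx j⟩) _).1 rfl⟩)
      (fun j => ⟨v j, hDmem _⟩) (fun j => (v j).2)
    exact ⟨⟨y, hy⟩, (snocMem hDmem v ⟨y, hy⟩).1 h⟩
  have unique : ∀ (n : ℕ) (f : L.Functions n) (v : Fin n → ZFElem (U.star (c none) : ZFSet.{u}))
      (y y' : ZFElem (U.star (c none) : ZFSet.{u})),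
        (zfTuple fun j : Fin (n + 1) =>
          ((Fin.snoc (α := fun _ => ZFElem (U.star (c none) : ZFSet.{u})) v y j :
              ZFElem (U.star (c none) : ZFSet.{u})) : ZFSet.{u})) ∈
            (U.star (c (some (Sum.inl ⟨n, f⟩))) : ZFSet.{u}) →
        (zfTuple fun j : Fin (n + 1) =>
          ((Fin.snoc (α := fun _ => ZFElem (U.star (c none) : ZFSet.{u})) v y' j :
              ZFElem (U.star (c none) : ZFSet.{u})) : ZFSet.{u})) ∈
            (U.star (c (some (Sum.inl ⟨n, f⟩))) : ZFSet.{u}) → y = y' := by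
    intro n f v y y' hy hy'
    have := (U.transfer_isBounded (IsBounded.allTuple none (P := fun X v x =>
      ∀ y : superstructure X, (y : ZFSet.{u}) ∈ (v none : ZFSet.{u}) →
      ∀ y' : superstructure X, (y' : ZFSet.{u}) ∈ (v none : ZFSet.{u}) →
        ((zfTuple fun j : Fin (n + 1) => ((Fin.snoc (α := fun _ => superstructure X) x y j :
          superstructure X) : ZFSet.{u})) ∈ (v (some (Sum.inl ⟨n, f⟩)) : ZFSet.{u}) ∧
        (zfTuple fun j : Fin (n + 1) => ((Fin.snoc (α := fun _ => superstructure X) x y' j :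
          superstructure X) : ZFSet.{u})) ∈ (v (some (Sum.inl ⟨n, f⟩)) : ZFSet.{u})) →
          (y : ZFSet.{u}) = (y' : ZFSet.{u}))
      (IsBounded.all (Sum.inl none) (IsBounded.all (some (Sum.inl none))
        (((IsBounded.tupleSnocMem (ι := Option (Option (L.CodeIndex ⊕ Fin n)))
          (some (some (Sum.inl (some (Sum.inl ⟨n, f⟩)))))
          (fun j => some (some (Sum.inr j))) (some none)).and
        (IsBounded.tupleSnocMem (ι := Option (Option (L.CodeIndex ⊕ Fin n)))
          (some (some (Sum.inl (some (Sum.inl ⟨n, f⟩)))))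
          (fun j => some (some (Sum.inr j))) none)).imp (IsBounded.eq (some none) none))))) c).1
      (fun x hx y hy y' hy' h => by
        have h1 := (hc.funMap_eq_iff hX f (fun j => ⟨x j, hx j⟩) ⟨y, hy⟩).2 h.1
        have h2 := (hc.funMap_eq_iff hX f (fun j => ⟨x j, hx j⟩) ⟨y', hy'⟩).2 h.2
        exact Subtype.mk.inj (h1.symm.trans h2))
      (fun j => ⟨v j, hDmem _⟩) (fun j => (v j).2) ⟨y, hDmem y⟩ y.2 ⟨y', hDmem y'⟩ y'.2
      ⟨(snocMem hDmem v y).2 hy, (snocMem hDmem v y').2 hy'⟩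
    exact Subtype.ext this
  choose F hF using total
  let inst : L.Structure (ZFElem (U.star (c none) : ZFSet.{u})) :=
    { funMap := fun {n} f v => F n f v
      RelMap := fun {n} r v => (zfTuple fun j => (v j : ZFSet.{u})) ∈
        (U.star (c (some (Sum.inr ⟨n, r⟩))) : ZFSet.{u}) }
  have hc' : L.IsCoded U.Y fun i => U.star (c i) := by
    refine ⟨hD', fun n f z => ⟨fun hz => ?_, ?_⟩, fun n r z => ⟨fun hz => ?_, ?_⟩⟩
    · obtain ⟨v, rfl⟩ := sub _ ⟨_, hc.functions n f⟩ z hz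
      refine ⟨v, ?_, rfl⟩
      refine unique n f (Fin.init v) _ _ ?_ (hF n f (Fin.init v))
      rw [Fin.snoc_init_self]
      exact hz
    · rintro ⟨v, hv, rfl⟩
      have := hF n f (Fin.init v)
      have hv' : v (Fin.last n) = F n f (Fin.init v) := hv
      rwa [← hv', Fin.snoc_init_self] at this
    · obtain ⟨v, rfl⟩ := sub _ ⟨_, hc.relations n r⟩ z hz
      exact ⟨v, hz, rfl⟩
    · rintro ⟨v, hv, rfl⟩
      exact hv
  refine ⟨inst, ⟨U.isInternalSet_star hc.notMem, ?_, fun n f => ⟨_, U.isInternalSet_star ?_,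
    hc'.functions n f⟩, fun n r => ⟨_, U.isInternalSet_star ?_, hc'.relations n r⟩⟩, ?_⟩
  · obtain ⟨x, hx⟩ := hne
    exact ⟨_, U.star_mem_star
      (a := ⟨x, hX.mem_superstructure_of_mem (c none).2 hc.notMem hx⟩).2 hx⟩
  · exact hX.notMem_of_codesRel (c none).2 hc.notMem (hc.functions n f)
  · exact hX.notMem_of_codesRel (c none).2 hc.notMem (hc.relations n r)
  · rw [FirstOrder.Language.elementarilyEquivalent_iff]
    intro φ
    obtain ⟨P, hP, hPr⟩ := FirstOrder.Language.BoundedFormula.exists_isBounded φ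
    have h1 := hPr U.X hX c hc default
    have h2 := hPr U.Y hY (fun i => U.star (c i)) hc' default
    refine h1.trans ((U.transfer_isBounded hP _).trans (Iff.trans (iff_of_eq ?_) h2.symm))
    refine congrArg _ (funext fun i => ?_)
    rcases i with i | i
    · rfl
    · exact i.elim0

end NonstandardUniverse

/-! ### Disjoint sums of two structures -/

namespace FirstOrder.Language

/-- The relation symbols for the disjoint sum of two `L`-structures: a unary predicate for the
first summand and, for each of the two summands, the relation symbols of `L` and the graphs of
the function symbols of `L`. The summands are indexed by `true` and `false`. -/
inductive PairRel (L : FirstOrder.Language.{u, u}) : ℕ → Type u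
  | left : PairRel L 1
  | rel (b : Bool) {n : ℕ} (r : L.Relations n) : PairRel L n
  | graph (b : Bool) {n : ℕ} (f : L.Functions n) : PairRel L (n + 1)

/-- The relational language of disjoint sums of two `L`-structures. -/
def pairLang (L : FirstOrder.Language.{u, u}) : FirstOrder.Language.{u, u} where
  Functions := fun _ => PEmpty
  Relations := PairRel L

variable {L : FirstOrder.Language.{u, u}}

section Sum

variable {M : Bool → Type*} [∀ b, L.Structure (M b)]

/-- The interpretation of the relation symbols in the disjoint sum. -/
def PairRel.Holds : {n : ℕ} → PairRel L n → (Fin n → Σ b, M b) → Prop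
  | _, .left, v => (v 0).1 = true
  | _, .rel b r, v => ∃ w : Fin _ → M b, (∀ i, v i = ⟨b, w i⟩) ∧ Structure.RelMap r w
  | _, .graph b f, v => ∃ w : Fin _ → M b, (∀ i, v i = ⟨b, w i⟩) ∧
      w ∈ _root_.graphRel fun x => Structure.funMap f x

instance pairStructure : (pairLang L).Structure (Σ b, M b) where
  funMap f := PEmpty.elim f
  RelMap r v := r.Holds v

theorem exists_eq_sigma_mk_iff {n : ℕ} {s : Fin n → Bool} {a : ∀ b, Fin n → M b} {b : Bool}
    {P : (Fin n → M b) → Prop} :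
    (∃ w : Fin n → M b, (∀ i, (⟨s i, a (s i) i⟩ : Σ b, M b) = ⟨b, w i⟩) ∧ P w) ↔
      (∀ i, s i = b) ∧ P (a b) := by
  constructor
  · rintro ⟨w, hw, h⟩
    have hs : ∀ i, s i = b := fun i => congrArg Sigma.fst (hw i)
    refine ⟨hs, ?_⟩
    obtain rfl : w = a b := by
      funext i
      have := hw i
      rw [hs i] at this
      exact (eq_of_heq (Sigma.mk.inj this).2).symm
    exact h
  · rintro ⟨hs, h⟩
    exact ⟨a b, fun i => by rw [hs i], h⟩

theorem relMap_rel_mk {n : ℕ} (b : Bool) (r : L.Relations n) (w : Fin n → M b) :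
    Structure.RelMap (L := pairLang L) (PairRel.rel b r) (fun i => (⟨b, w i⟩ : Σ b, M b)) ↔
      Structure.RelMap r w := by
  constructor
  · rintro ⟨w', hw, h⟩
    obtain rfl : w = w' := funext fun i => eq_of_heq (Sigma.mk.inj (hw i)).2
    exact h
  · exact fun h => ⟨w, fun _ => rfl, h⟩

theorem relMap_graph_mk {n : ℕ} (b : Bool) (f : L.Functions n) (w : Fin (n + 1) → M b) :
    Structure.RelMap (L := pairLang L) (PairRel.graph b f) (fun i => (⟨b, w i⟩ : Σ b, M b)) ↔
      w (Fin.last n) = Structure.funMap f (Fin.init w) := by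
  constructor
  · rintro ⟨w', hw, h⟩
    obtain rfl : w = w' := funext fun i => eq_of_heq (Sigma.mk.inj (hw i)).2
    exact h
  · exact fun h => ⟨w, fun _ => rfl, h⟩

end Sum

/-- Two tuples, in possibly different structures, satisfy the same formulas from `Φ`. -/
def Agree {n : ℕ} (Φ : Finset (L.BoundedFormula Empty n)) {M N : Type*} [L.Structure M]
    [L.Structure N] (a : Fin n → M) (a' : Fin n → N) : Prop :=
  ∀ ψ ∈ Φ, ψ.Realize default a ↔ ψ.Realize default a'

theorem Agree.symm {n : ℕ} {Φ : Finset (L.BoundedFormula Empty n)} {M N : Type*} [L.Structure M]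
    [L.Structure N] {a : Fin n → M} {a' : Fin n → N} (h : Agree Φ a a') : Agree Φ a' a :=
  fun ψ hψ => (h ψ hψ).symm

theorem Agree.mono {n : ℕ} {Φ Ψ : Finset (L.BoundedFormula Empty n)} {M N : Type*}
    [L.Structure M] [L.Structure N] {a : Fin n → M} {a' : Fin n → N} (h : Agree Ψ a a')
    (hs : Φ ⊆ Ψ) : Agree Φ a a' :=
  fun ψ hψ => h ψ (hs hψ)

/-- For each finite `Φ` there is a finite `Ψ`, saying which truth values for `Φ` are realized by
some further element, such that agreement on `Ψ` allows a back-and-forth step for `Φ`. -/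
theorem exists_agree_snoc {n : ℕ} (Φ : Finset (L.BoundedFormula Empty (n + 1))) :
    ∃ Ψ : Finset (L.BoundedFormula Empty n), ∀ (M N : Type w) [L.Structure M] [L.Structure N]
      (a : Fin n → M) (a' : Fin n → N), Agree Ψ a a' → ∀ c : M, ∃ c' : N,
        Agree Φ (Fin.snoc (α := fun _ => M) a c) (Fin.snoc (α := fun _ => N) a' c') := by
  classical
  let F : Finset (L.BoundedFormula Empty (n + 1)) → L.BoundedFormula Empty n := fun T =>
    (BoundedFormula.iInf fun ψ : Φ => if ψ.1 ∈ T then ψ.1 else ψ.1.not).ex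
  refine ⟨Φ.powerset.image F, fun M N _ _ a a' h c => ?_⟩
  have hT := h (F (Φ.filter fun ψ => ψ.Realize default (Fin.snoc (α := fun _ => M) a c)))
    (Finset.mem_image_of_mem F (Finset.mem_powerset.2 (Finset.filter_subset _ _)))
  simp only [F, BoundedFormula.realize_ex, BoundedFormula.realize_iInf] at hT
  obtain ⟨c', hc'⟩ := hT.1 ⟨c, fun ψ => by
    by_cases hψ : ψ.1.Realize default (Fin.snoc (α := fun _ => M) a c) <;> simp [hψ]⟩
  refine ⟨c', fun ψ hψ => ?_⟩
  have := hc' ⟨ψ, hψ⟩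
  by_cases hr : ψ.Realize default (Fin.snoc (α := fun _ => M) a c)
  · simpa [hr, hψ] using this
  · simpa [hr, hψ] using this

theorem exists_eq_var_of_pairLang {n : ℕ} (t : (pairLang L).Term (Empty ⊕ Fin n)) :
    ∃ i, t = Term.var (Sum.inr i) := by
  rcases t with (i | i) | f
  · exact i.elim
  · exact ⟨i, rfl⟩
  · exact PEmpty.elim f

theorem snoc_sigma_mk {M : Bool → Type*} {n : ℕ} (s : Fin n → Bool) (a : ∀ b, Fin n → M b)
    (c : ∀ b, M b) (b : Bool) :
    (Fin.snoc (α := fun _ => Σ b, M b) (fun i => ⟨s i, a (s i) i⟩) ⟨b, c b⟩ :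
      Fin (n + 1) → Σ b, M b) =
    fun i => ⟨Fin.snoc (α := fun _ => Bool) s b i,
      Fin.snoc (α := fun _ => M (Fin.snoc (α := fun _ => Bool) s b i)) (a _) (c _) i⟩ := by
  funext i
  refine Fin.lastCases ?_ (fun i => ?_) i
  · have h : Fin.snoc (α := fun _ => Bool) s b (Fin.last n) = b := Fin.snoc_last ..
    rw [h, Fin.snoc_last, Fin.snoc_last]
  · have h : Fin.snoc (α := fun _ => Bool) s b i.castSucc = s i := Fin.snoc_castSucc ..
    rw [h, Fin.snoc_castSucc, Fin.snoc_castSucc]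

/-- The Feferman–Vaught property of disjoint sums: once the summands of the variables are fixed,
the truth of a formula in a sum depends on the truth of finitely many formulas in the summands. -/
theorem BoundedFormula.exists_agree_pair {n : ℕ} (φ : (pairLang L).BoundedFormula Empty n) :
    ∀ s : Fin n → Bool, ∃ Φ : Finset (L.BoundedFormula Empty n), ∀ (M N : Bool → Type w)
      [∀ b, L.Structure (M b)] [∀ b, L.Structure (N b)] [∀ b, Nonempty (M b)]
      [∀ b, Nonempty (N b)] (a : ∀ b, Fin n → M b) (a' : ∀ b, Fin n → N b),
      (∀ b, Agree Φ (a b) (a' b)) →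
        (φ.Realize default (fun i => (⟨s i, a (s i) i⟩ : Σ b, M b)) ↔
          φ.Realize default (fun i => (⟨s i, a' (s i) i⟩ : Σ b, N b))) := by
  classical
  induction φ with
  | falsum => exact fun s => ⟨∅, fun M N _ _ _ _ a a' _ => Iff.rfl⟩
  | equal t₁ t₂ =>
    intro s
    obtain ⟨i, rfl⟩ := exists_eq_var_of_pairLang t₁
    obtain ⟨j, rfl⟩ := exists_eq_var_of_pairLang t₂
    have key : ∀ (M : Bool → Type w) (a : ∀ b, Fin _ → M b),
        (⟨s i, a (s i) i⟩ : Σ b, M b) = ⟨s j, a (s j) j⟩ ↔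
          s i = s j ∧ a (s j) i = a (s j) j := by
      intro M a
      by_cases h : s i = s j
      · rw [h]; simp
      · simp [h]
    refine ⟨{Term.bdEqual (Term.var (Sum.inr i)) (Term.var (Sum.inr j))},
      fun M N _ _ _ _ a a' h => ?_⟩
    have h' := h (s j) _ (Finset.mem_singleton_self _)
    simp only [realize_bdEqual, Term.realize_var, Sum.elim_inr] at h'
    simp only [Realize, Term.realize_var, Sum.elim_inr]
    rw [key M a, key N a', h']
  | rel R ts =>
    intro s
    choose g hg using fun i => exists_eq_var_of_pairLang (ts i)
    cases R with
    | left => exact ⟨∅, fun M N _ _ _ _ a a' _ => by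
        simp [Realize, hg, Structure.RelMap, PairRel.Holds]⟩
    | rel b r =>
      refine ⟨{r.boundedFormula fun i => Term.var (Sum.inr (g i))},
        fun M N _ _ _ _ a a' h => ?_⟩
      have h' := h b _ (Finset.mem_singleton_self _)
      simp only [realize_rel, Term.realize_var, Sum.elim_inr] at h'
      simp only [Realize, hg, Term.realize_var, Sum.elim_inr]
      have h1 := exists_eq_sigma_mk_iff (s := s ∘ g) (a := fun b i => a b (g i))
        (b := b) (P := Structure.RelMap r)
      have h2 := exists_eq_sigma_mk_iff (s := s ∘ g) (a := fun b i => a' b (g i))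
        (b := b) (P := Structure.RelMap r)
      exact h1.trans ((and_congr_right' h').trans h2.symm)
    | @graph b k f =>
      refine ⟨{Term.bdEqual (Term.var (Sum.inr (g (Fin.last k))))
        (Term.func f fun i => Term.var (Sum.inr (g i.castSucc)))}, fun M N _ _ _ _ a a' h => ?_⟩
      have h' := h b _ (Finset.mem_singleton_self _)
      simp only [realize_bdEqual, Term.realize_var, Term.realize_func, Sum.elim_inr] at h'
      simp only [Realize, hg, Term.realize_var, Sum.elim_inr]
      have h1 := exists_eq_sigma_mk_iff (s := s ∘ g) (a := fun b i => a b (g i))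
        (b := b) (P := fun w => w ∈ _root_.graphRel fun x => Structure.funMap f x)
      have h2 := exists_eq_sigma_mk_iff (s := s ∘ g) (a := fun b i => a' b (g i))
        (b := b) (P := fun w => w ∈ _root_.graphRel fun x => Structure.funMap f x)
      exact h1.trans ((and_congr_right' h').trans h2.symm)
  | imp φ ψ ih1 ih2 =>
    intro s
    obtain ⟨Φ, hΦ⟩ := ih1 s
    obtain ⟨Ψ, hΨ⟩ := ih2 s
    exact ⟨Φ ∪ Ψ, fun M N _ _ _ _ a a' h => imp_congr
      (hΦ M N a a' fun b => (h b).mono Finset.subset_union_left)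
      (hΨ M N a a' fun b => (h b).mono Finset.subset_union_right)⟩
  | @all n φ ih =>
    intro s
    choose Φ hΦ using fun b => ih (Fin.snoc (α := fun _ => Bool) s b)
    obtain ⟨Ψ, hΨ⟩ := exists_agree_snoc (Φ true ∪ Φ false)
    have step : ∀ (M N : Bool → Type w) [∀ b, L.Structure (M b)] [∀ b, L.Structure (N b)]
        [∀ b, Nonempty (M b)] [∀ b, Nonempty (N b)] (a : ∀ b, Fin n → M b)
        (a' : ∀ b, Fin n → N b), (∀ b, Agree Ψ (a b) (a' b)) →
        φ.all.Realize default (fun i => (⟨s i, a' (s i) i⟩ : Σ b, N b)) →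
        φ.all.Realize default (fun i => (⟨s i, a (s i) i⟩ : Σ b, M b)) := by
      rintro M N _ _ _ _ a a' h hN ⟨b, x⟩
      obtain ⟨c, rfl⟩ : ∃ c : ∀ b, M b, c b = x :=
        ⟨Function.update (fun b => Classical.arbitrary (M b)) b x, by simp⟩
      choose c' hc' using fun b => hΨ (M b) (N b) (a b) (a' b) (h b) (c b)
      have hN' := hN ⟨b, c' b⟩
      rw [snoc_sigma_mk] at hN' ⊢
      refine (hΦ b M N (fun b => Fin.snoc (α := fun _ => M b) (a b) (c b))
        (fun b => Fin.snoc (α := fun _ => N b) (a' b) (c' b)) fun b' => (hc' b').mono ?_).2 hN'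
      cases b
      · exact Finset.subset_union_right
      · exact Finset.subset_union_left
    exact ⟨Ψ, fun M N _ _ _ _ a a' h =>
      ⟨step N M a' a fun b => (h b).symm, step M N a a' h⟩⟩

/-- Disjoint sums of elementarily equivalent structures are elementarily equivalent. -/
theorem elementarilyEquivalent_pair (M N : Bool → Type w) [∀ b, L.Structure (M b)]
    [∀ b, L.Structure (N b)] [∀ b, Nonempty (M b)] [∀ b, Nonempty (N b)]
    (h : ∀ b, M b ≅[L] N b) : (Σ b, M b) ≅[pairLang L] (Σ b, N b) := by
  rw [elementarilyEquivalent_iff]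
  intro φ
  obtain ⟨Φ, hΦ⟩ := BoundedFormula.exists_agree_pair φ default
  have := hΦ M N (fun b => default) (fun b => default)
    fun b ψ _ => (h b).realize_sentence ψ
  have key : ∀ (K : Type _) [(pairLang L).Structure K] (x : Fin 0 → K),
      BoundedFormula.Realize φ default x ↔ K ⊨ φ := fun K _ x => by
    rw [Subsingleton.elim x default]; rfl
  exact (key _ _).symm.trans (this.trans (key _ _))

/-! ### Isomorphisms between the summands of a disjoint sum -/

/-- `x` lies in the first summand of a structure for the language of sums. -/
abbrev InLeft (L : FirstOrder.Language.{u, u}) {K : Type*} [(pairLang L).Structure K] (x : K) :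
    Prop :=
  Structure.RelMap (L := pairLang L) PairRel.left ![x]

/-- The binary predicate `X` holds of `x` and `y`. -/
abbrev Related {K : Type*} [(newPredLang 2).Structure K] (x y : K) : Prop :=
  Structure.RelMap (L := newPredLang 2) NewPred.X ![x, y]

/-- The binary relation `X` on a structure `K` for the language of sums is (the graph of) an
isomorphism between the two summands. -/
structure IsPairIso (L : FirstOrder.Language.{u, u}) (K : Type*) [(pairLang L).Structure K]
    [(newPredLang 2).Structure K] : Prop where
  total : ∀ x : K, InLeft L x →
    ∃ y : K, ¬ InLeft L y ∧ Related x y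
  surjective : ∀ y : K, ¬ InLeft L y →
    ∃ x : K, InLeft L x ∧ Related x y
  eq_iff : ∀ x y x' y' : K, Related x y → Related x' y' → (x = x' ↔ y = y')
  rel : ∀ (n : ℕ) (r : L.Relations n) (v w : Fin n → K), (∀ i, Related (v i) (w i)) →
    (Structure.RelMap (L := pairLang L) (PairRel.rel true r) v ↔
      Structure.RelMap (L := pairLang L) (PairRel.rel false r) w)
  graph : ∀ (n : ℕ) (f : L.Functions n) (v w : Fin (n + 1) → K), (∀ i, Related (v i) (w i)) →
    (Structure.RelMap (L := pairLang L) (PairRel.graph true f) v ↔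
      Structure.RelMap (L := pairLang L) (PairRel.graph false f) w)

section Sentences

/-- A relation symbol of `L` as a symbol of `L ∪ {X}`. -/
def oldSymbol {L : FirstOrder.Language.{u, u}} (n : ℕ) {k : ℕ} (R : L.Relations k) :
    (withPred L n).Relations k := Sum.inl R

/-- The new predicate symbol `X` as a symbol of `L ∪ {X}`. -/
def newSymbol (L : FirstOrder.Language.{u, u}) (n : ℕ) : (withPred L n).Relations n :=
  Sum.inr NewPred.X

variable (L)

/-- The sentence `∀ x (left x → ∃ y (¬ left y ∧ X x y))`. -/
def totalSentence : (withPred (pairLang L) 2).Sentence :=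
  ((Relations.boundedFormula₁ (oldSymbol 2 (L := pairLang L) PairRel.left) (&0)).imp
    ((Relations.boundedFormula₁ (oldSymbol 2 (L := pairLang L) PairRel.left) (&1)).not ⊓
      Relations.boundedFormula₂ (newSymbol (pairLang L) 2) (&0) (&1)).ex).all

/-- The sentence `∀ y (¬ left y → ∃ x (left x ∧ X x y))`. -/
def surjectiveSentence : (withPred (pairLang L) 2).Sentence :=
  ((Relations.boundedFormula₁ (oldSymbol 2 (L := pairLang L) PairRel.left) (&0)).not.imp
    (Relations.boundedFormula₁ (oldSymbol 2 (L := pairLang L) PairRel.left) (&1) ⊓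
      Relations.boundedFormula₂ (newSymbol (pairLang L) 2) (&1) (&0)).ex).all

/-- The sentence `∀ x y x' y' (X x y → X x' y' → (x = x' ↔ y = y'))`. -/
def eqIffSentence : (withPred (pairLang L) 2).Sentence :=
  ((Relations.boundedFormula₂ (n := 4)
      (newSymbol (pairLang L) 2) (&0) (&1)).imp
    ((Relations.boundedFormula₂ (newSymbol (pairLang L) 2) (&2) (&3)).imp
      ((Term.bdEqual (&0) (&2)).iff (Term.bdEqual (&1) (&3))))).all.all.all.all

variable {L}

/-- The sentence saying that `X` carries the relation `R` to the relation `R'`. -/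
noncomputable def relSentence {n : ℕ} (R R' : (pairLang L).Relations n) :
    (withPred (pairLang L) 2).Sentence :=
  Formula.iAlls (Fin n × Bool)
    ((Formula.iInf fun i => Relations.formula₂ (newSymbol (pairLang L) 2)
        (Term.var (Sum.inr (i, true))) (Term.var (Sum.inr (i, false)))).imp
      ((Relations.formula (oldSymbol 2 R)
          fun i => Term.var (Sum.inr (i, true))).iff
        (Relations.formula (oldSymbol 2 R')
          fun i => Term.var (Sum.inr (i, false)))))

variable (K : Type*) [(pairLang L).Structure K] [(newPredLang 2).Structure K]

theorem realize_totalSentence :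
    K ⊨ totalSentence L ↔
      ∀ x : K, InLeft L x →
        ∃ y : K, ¬ InLeft L y ∧ Related x y := by
  simp only [totalSentence, Sentence.Realize, Formula.Realize, BoundedFormula.realize_all,
    BoundedFormula.realize_imp, BoundedFormula.realize_ex, BoundedFormula.realize_inf,
    BoundedFormula.realize_not, BoundedFormula.realize_rel₁, BoundedFormula.realize_rel₂]
  rfl

theorem realize_surjectiveSentence :
    K ⊨ surjectiveSentence L ↔
      ∀ y : K, ¬ InLeft L y →
        ∃ x : K, InLeft L x ∧ Related x y := by
  simp only [surjectiveSentence, Sentence.Realize, Formula.Realize, BoundedFormula.realize_all,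
    BoundedFormula.realize_imp, BoundedFormula.realize_ex, BoundedFormula.realize_inf,
    BoundedFormula.realize_not, BoundedFormula.realize_rel₁, BoundedFormula.realize_rel₂]
  rfl

theorem realize_eqIffSentence :
    K ⊨ eqIffSentence L ↔
      ∀ x y x' y' : K, Related x y → Related x' y' → (x = x' ↔ y = y') := by
  simp only [eqIffSentence, Sentence.Realize, Formula.Realize, BoundedFormula.realize_all,
    BoundedFormula.realize_imp, BoundedFormula.realize_iff, BoundedFormula.realize_bdEqual,
    BoundedFormula.realize_rel₂]
  rfl

theorem realize_relSentence {n : ℕ} (R R' : (pairLang L).Relations n) :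
    K ⊨ relSentence R R' ↔
      ∀ v w : Fin n → K, (∀ i, Related (v i) (w i)) →
        (Structure.RelMap R v ↔ Structure.RelMap R' w) := by
  simp only [relSentence, Sentence.Realize, Formula.realize_iAlls, Formula.realize_imp,
    Formula.realize_iff, Formula.realize_iInf, Formula.realize_rel₂, Formula.realize_rel,
    Term.realize_var, Sum.elim_inr]
  exact ⟨fun h v w => h fun p => cond p.2 (v p.1) (w p.1), fun h i => h _ _⟩

end Sentences

/-- Being an isomorphism between the summands is expressed by sentences in the new predicate. -/
theorem IsPairIso.of_model {K K' : Type*} [(pairLang L).Structure K] [(pairLang L).Structure K']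
    [(newPredLang 2).Structure K] [(newPredLang 2).Structure K'] (hX : IsPairIso L K)
    (h : ∀ φ : (withPred (pairLang L) 2).Sentence, K ⊨ φ → K' ⊨ φ) : IsPairIso L K' where
  total := (realize_totalSentence K').1 (h _ ((realize_totalSentence K).2 hX.total))
  surjective :=
    (realize_surjectiveSentence K').1 (h _ ((realize_surjectiveSentence K).2 hX.surjective))
  eq_iff := (realize_eqIffSentence K').1 (h _ ((realize_eqIffSentence K).2 hX.eq_iff))
  rel n r := (realize_relSentence K' (PairRel.rel true r) (PairRel.rel false r)).1
    (h _ ((realize_relSentence K (PairRel.rel true r) (PairRel.rel false r)).2 (hX.rel n r)))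
  graph n f := (realize_relSentence K' (PairRel.graph true f) (PairRel.graph false f)).1
    (h _ ((realize_relSentence K (PairRel.graph true f) (PairRel.graph false f)).2 (hX.graph n f)))

theorem relMap_left_mk {M : Bool → Type*} [∀ b, L.Structure (M b)] (x : Σ b, M b) :
    InLeft L x ↔ x.1 = true := Iff.rfl

/-- In the sum of two copies of a structure, the identity is an isomorphism of the summands. -/
theorem isPairIso_id (A : Type*) [L.Structure A] :
    let _ := newPredStructure
      {v : Fin 2 → Σ _ : Bool, A | ∃ a, v 0 = ⟨true, a⟩ ∧ v 1 = ⟨false, a⟩}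
    IsPairIso L (Σ _ : Bool, A) :=
  let _ := newPredStructure
    {v : Fin 2 → Σ _ : Bool, A | ∃ a, v 0 = ⟨true, a⟩ ∧ v 1 = ⟨false, a⟩}
  { total := by
      rintro ⟨b, a⟩ (rfl : b = true)
      exact ⟨⟨false, a⟩, Bool.false_ne_true, a, rfl, rfl⟩
    surjective := by
      rintro ⟨b, a⟩ hb
      obtain rfl : b = false := by simpa [relMap_left_mk] using hb
      exact ⟨⟨true, a⟩, rfl, a, rfl, rfl⟩
    eq_iff := by
      rintro x y x' y' ⟨a, hx, hy⟩ ⟨a', hx', hy'⟩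
      obtain rfl : x = ⟨true, a⟩ := hx
      obtain rfl : y = ⟨false, a⟩ := hy
      obtain rfl : x' = ⟨true, a'⟩ := hx'
      obtain rfl : y' = ⟨false, a'⟩ := hy'
      simp
    rel n r v w h := by
      choose a hv hw using h
      obtain rfl : v = fun i => ⟨true, a i⟩ := funext hv
      obtain rfl : w = fun i => ⟨false, a i⟩ := funext hw
      exact (relMap_rel_mk (M := fun _ => A) true r a).trans
        (relMap_rel_mk (M := fun _ => A) false r a).symm
    graph n f v w h := by
      choose a hv hw using h
      obtain rfl : v = fun i => ⟨true, a i⟩ := funext hv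
      obtain rfl : w = fun i => ⟨false, a i⟩ := funext hw
      exact (relMap_graph_mk (M := fun _ => A) true f a).trans
        (relMap_graph_mk (M := fun _ => A) false f a).symm }

theorem IsPairIso.nonempty_equiv {M : Bool → Type*} [∀ b, L.Structure (M b)] {K : Type*}
    [(pairLang L).Structure K] [(newPredLang 2).Structure K] (e : (Σ b, M b) ≃[pairLang L] K)
    (hX : IsPairIso L K) : Nonempty (M true ≃[L] M false) := by
  have hleft : ∀ x : Σ b, M b, InLeft L (e x) ↔ x.1 = true := by
    intro x
    refine Iff.trans (iff_of_eq (congrArg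
      (Structure.RelMap (L := pairLang L) (PairRel.left : (pairLang L).Relations 1))
      (funext fun i => ?_)))
      (e.map_rel (PairRel.left : (pairLang L).Relations 1) ![x])
    fin_cases i
    rfl
  have h1 : ∀ a : M true, ∃ a' : M false, Related (e ⟨true, a⟩) (e ⟨false, a'⟩) := by
    intro a
    obtain ⟨y, hy, hX⟩ := hX.total (e ⟨true, a⟩) ((hleft _).2 rfl)
    obtain ⟨⟨b, a'⟩, rfl⟩ := e.surjective y
    obtain rfl : b = false := by simpa [hleft] using hy
    exact ⟨a', hX⟩
  have h2 : ∀ a' : M false, ∃ a : M true, Related (e ⟨true, a⟩) (e ⟨false, a'⟩) := by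
    intro a'
    obtain ⟨x, hx, hX⟩ := hX.surjective (e ⟨false, a'⟩) (by simp [hleft])
    obtain ⟨⟨b, a⟩, rfl⟩ := e.surjective x
    obtain rfl : b = true := (hleft _).1 hx
    exact ⟨a, hX⟩
  choose g hg using h1
  have hbij : Function.Bijective g := by
    constructor
    · intro a a' haa
      have := (hX.eq_iff _ _ _ _ (hg a) (hg a')).2 (by rw [haa])
      simpa using this
    · intro a'
      obtain ⟨a, ha⟩ := h2 a'
      have := (hX.eq_iff _ _ _ _ (hg a) ha).1 rfl
      exact ⟨a, by simpa using this⟩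
  refine ⟨⟨Equiv.ofBijective g hbij, fun {n} f x => ?_, fun {n} r x => ?_⟩⟩
  · have h := hX.graph n f
      (fun i => e ⟨true, Fin.snoc (α := fun _ => M true) x (Structure.funMap f x) i⟩)
      (fun i => e ⟨false, g (Fin.snoc (α := fun _ => M true) x (Structure.funMap f x) i)⟩)
      (fun i => hg _)
    have h3 := e.map_rel (PairRel.graph true f : (pairLang L).Relations (n + 1))
      (fun i => ⟨true, Fin.snoc (α := fun _ => M true) x (Structure.funMap f x) i⟩)
    have h4 := e.map_rel (PairRel.graph false f : (pairLang L).Relations (n + 1))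
      (fun i => ⟨false, g (Fin.snoc (α := fun _ => M true) x (Structure.funMap f x) i)⟩)
    have h5 := (h3.symm.trans (h.trans h4)).1 ((relMap_graph_mk true f _).2 (by simp))
    have h6 := (relMap_graph_mk false f
      (fun i => g (Fin.snoc (α := fun _ => M true) x (Structure.funMap f x) i))).1 h5
    rw [Fin.snoc_last] at h6
    refine h6.trans (congrArg _ (funext fun i => ?_))
    simp [Fin.init]
  · have h := hX.rel n r (fun i => e ⟨true, x i⟩) (fun i => e ⟨false, g (x i)⟩) (fun i => hg _)
    have h3 := e.map_rel (PairRel.rel true r : (pairLang L).Relations n) (fun i => ⟨true, x i⟩)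
    have h4 := e.map_rel (PairRel.rel false r : (pairLang L).Relations n)
      (fun i => ⟨false, g (x i)⟩)
    exact (relMap_rel_mk false r _).symm.trans
      ((h3.symm.trans (h.trans h4)).symm.trans (relMap_rel_mk true r _))

theorem card_pairLang_lt {κ : Cardinal.{u}} (hκ : ℵ₀ ≤ κ) (h : L.card < κ) :
    (pairLang L).card < κ := by
  let g : (Σ n, (pairLang L).Functions n) ⊕ (Σ n, (pairLang L).Relations n) →
      Option (Bool × L.Symbols)
    | .inl f => f.2.elim
    | .inr ⟨_, .left⟩ => none
    | .inr ⟨_, .rel b r⟩ => some (b, Sum.inr ⟨_, r⟩)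
    | .inr ⟨_, .graph b f⟩ => some (b, Sum.inl ⟨_, f⟩)
  have hg : Function.Injective g := by
    rintro (⟨_, ⟨⟩⟩ | ⟨_, _ | _ | _⟩) (⟨_, ⟨⟩⟩ | ⟨_, _ | _ | _⟩) h <;>
      simp only [g, Option.some.injEq, Prod.mk.injEq, Sum.inl.injEq, Sum.inr.injEq, reduceCtorEq,
        and_false, Sigma.mk.injEq] at h <;>
      first
      | rfl
      | (obtain ⟨rfl, rfl, h⟩ := h; cases h; rfl)
  refine (Cardinal.mk_le_of_injective hg).trans_lt ?_
  rw [Cardinal.mk_option, Cardinal.mk_prod]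
  refine Cardinal.add_lt_of_lt hκ (Cardinal.mul_lt_of_lt hκ ?_ ?_)
    (Cardinal.one_lt_aleph0.trans_le hκ)
  · simpa using (Cardinal.natCast_lt_aleph0 (n := 2)).trans_le hκ
  · simpa [Language.card] using h

end FirstOrder.Language

/-! ### Realizing types implies the isomorphism property -/

namespace NonstandardUniverse

open FirstOrder.Language

variable (U : NonstandardUniverse.{u})

/-- The bijection `a ↦ (a, t)` from `A` to `A × {t}`. -/
noncomputable def prodSingletonEquiv (A t : ZFSet.{u}) : ZFElem A ≃ ZFElem (A.prod {t}) :=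
  Equiv.ofBijective
    (fun a => ⟨ZFSet.pair a t, ZFSet.pair_mem_prod.2 ⟨a.2, ZFSet.mem_singleton.2 rfl⟩⟩) <| by
    constructor
    · intro a b h
      exact Subtype.ext (ZFSet.pair_injective (Subtype.mk.inj h)).1
    · rintro ⟨z, hz⟩
      obtain ⟨a, ha, t', ht', rfl⟩ := ZFSet.mem_prod.1 hz
      obtain rfl := ZFSet.mem_singleton.1 ht'
      exact ⟨⟨a, ha⟩, rfl⟩

variable {U} in
/-- An internal relation on `A` gives an internal relation on the copy `A × {t}`. -/
theorem exists_codesRel_prod_singleton {A t : ZFSet.{u}} (hA : U.IsInternalSet A)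
    (ht : U.IsInternal t) {n : ℕ} {r : Set (Fin n → ZFElem A)}
    (h : ∃ R, U.IsInternalSet R ∧ CodesRel A r R) :
    ∃ R, U.IsInternalSet R ∧
      CodesRel (A.prod {t}) {v | (fun i => (prodSingletonEquiv A t).symm (v i)) ∈ r} R := by
  obtain ⟨R, hR, hc⟩ := h
  refine U.exists_internal_codesRel (ι := Fin 3)
    (Q := fun X b v => ∃ x : Fin n → superstructure X,
      (∀ j, (x j : ZFSet.{u}) ∈ (b 0 : ZFSet.{u})) ∧
      ((∀ j, (v j : ZFSet.{u}) = ZFSet.pair (x j) (b 1)) ∧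
        (zfTuple fun j => (x j : ZFSet.{u})) ∈ (b 2 : ZFSet.{u})))
    (IsBounded.exTuple (Sum.inl 0) ((IsBounded.forallFin fun j =>
      IsBounded.eqPair (Sum.inl (Sum.inr j)) (Sum.inr j) (Sum.inl (Sum.inl 1))).and
        (IsBounded.tupleMem (Sum.inl (Sum.inl 2)) Sum.inr)))
    ![⟨A, hA.1.1⟩, ⟨t, ht.1⟩, ⟨R, hR.1.1⟩] ?_ (hA.prod_singleton ht) _ ?_
  · intro i
    fin_cases i
    exacts [hA.1, ht, hR.1]
  · intro v hv
    obtain ⟨a, ha⟩ : ∃ a : Fin n → ZFElem A, ∀ i, prodSingletonEquiv A t (a i) = ⟨v i, hv i⟩ :=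
      ⟨fun i => (prodSingletonEquiv A t).symm ⟨v i, hv i⟩, fun i => by simp⟩
    have hva : ∀ i, (v i : ZFSet.{u}) = ZFSet.pair (a i) t := fun i =>
      (congrArg Subtype.val (ha i)).symm
    simp only [Set.mem_ofPred_eq, ← ha, Equiv.symm_apply_apply]
    rw [hc.mem_iff]
    constructor
    · exact fun h =>
        ⟨fun i => ⟨a i, hA.mem_superstructure_of_mem (a i).2⟩, fun i => (a i).2, hva, h⟩
    · rintro ⟨x, hx, hvx, h⟩
      have : (fun j => (x j : ZFSet.{u})) = fun j => (a j : ZFSet.{u}) := funext fun j =>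
        (ZFSet.pair_injective ((hvx j).symm.trans (hva j))).1
      rw [← this]
      exact h

variable {U} in
/-- The copy `A × {t}` of an internally presented structure on `A` is internally presented. -/
theorem InternallyPresented.prod_singleton {L : FirstOrder.Language.{u, u}} {A t : ZFSet.{u}}
    [L.Structure (ZFElem A)] (hA : U.InternallyPresented L A) (ht : U.IsInternal t) :
    letI : L.Structure (ZFElem (A.prod {t})) := (prodSingletonEquiv A t).inducedStructure
    U.InternallyPresented L (A.prod {t}) := by
  let _ : L.Structure (ZFElem (A.prod {t})) := (prodSingletonEquiv A t).inducedStructure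
  obtain ⟨h1, ⟨a, ha⟩, h3, h4⟩ := hA
  refine ⟨h1.prod_singleton ht, ⟨_, (prodSingletonEquiv A t ⟨a, ha⟩).2⟩, fun n f => ?_,
    fun n r => exists_codesRel_prod_singleton h1 ht (h4 n r)⟩
  convert exists_codesRel_prod_singleton h1 ht (h3 n f) using 5
  ext v
  exact (prodSingletonEquiv A t).symm_apply_eq.symm

/-- The union of two disjoint sets as a disjoint sum. -/
noncomputable def sigmaEquivUnion (F : Bool → ZFSet.{u}) (h : ∀ z ∈ F true, z ∉ F false) :
    (Σ b, ZFElem (F b)) ≃ ZFElem (F true ∪ F false) :=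
  Equiv.ofBijective (fun x => ⟨x.2, ZFSet.mem_union.2 (by
    obtain ⟨b, x⟩ := x
    cases b
    exacts [Or.inr x.2, Or.inl x.2])⟩) <| by
    constructor
    · rintro ⟨b, x⟩ ⟨b', x'⟩ hx
      have hx' : (x : ZFSet.{u}) = x' := Subtype.mk.inj hx
      cases b <;> cases b'
      · exact congrArg _ (Subtype.ext hx')
      · exact (h x' x'.2 (hx' ▸ x.2)).elim
      · exact (h x x.2 (hx' ▸ x'.2)).elim
      · exact congrArg _ (Subtype.ext hx')
    · rintro ⟨z, hz⟩
      rcases ZFSet.mem_union.1 hz with h | h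
      · exact ⟨⟨true, z, h⟩, rfl⟩
      · exact ⟨⟨false, z, h⟩, rfl⟩

theorem coe_sigmaEquivUnion (F : Bool → ZFSet.{u}) (h : ∀ z ∈ F true, z ∉ F false)
    (x : Σ b, ZFElem (F b)) : (sigmaEquivUnion F h x : ZFSet.{u}) = x.2 := rfl

variable {U} in
/-- The union of two disjoint internally presented structures is internally presented. -/
theorem internallyPresented_union {L : FirstOrder.Language.{u, u}} {F : Bool → ZFSet.{u}}
    (h : ∀ z ∈ F true, z ∉ F false) [∀ b, L.Structure (ZFElem (F b))]
    (hF : ∀ b, U.InternallyPresented L (F b)) :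
    letI : (pairLang L).Structure (ZFElem (F true ∪ F false)) :=
      (sigmaEquivUnion F h).inducedStructure
    U.InternallyPresented (pairLang L) (F true ∪ F false) := by
  let _ : (pairLang L).Structure (ZFElem (F true ∪ F false)) :=
    (sigmaEquivUnion F h).inducedStructure
  refine ⟨(hF true).1.union (hF false).1, ?_, fun n f => PEmpty.elim f, fun n r => ?_⟩
  · obtain ⟨x, hx⟩ := (hF true).2.1
    exact ⟨x, ZFSet.mem_union.2 (Or.inl hx)⟩
  -- a relation on one summand, as a set of tuples, is also the relation on the union
  have key : ∀ {n : ℕ} (b : Bool) (r : Set (Fin n → ZFElem (F b)))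
      (hr : ∃ R, U.IsInternalSet R ∧ CodesRel (F b) r R),
      ∃ R, U.IsInternalSet R ∧ CodesRel (F true ∪ F false) {v | ∃ w : Fin n → ZFElem (F b),
        (∀ i, (sigmaEquivUnion F h).symm (v i) = ⟨b, w i⟩) ∧ w ∈ r} R := by
    rintro n b r ⟨R, hR, hc⟩
    refine ⟨R, hR, fun z => (hc z).trans ⟨?_, ?_⟩⟩
    · rintro ⟨w, hw, rfl⟩
      exact ⟨fun i => sigmaEquivUnion F h ⟨b, w i⟩, ⟨w, fun i => by simp, hw⟩, rfl⟩
    · rintro ⟨v, ⟨w, hv, hw⟩, rfl⟩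
      refine ⟨w, hw, congrArg zfTuple (funext fun i => ?_)⟩
      rw [(Equiv.symm_apply_eq _).1 (hv i), coe_sigmaEquivUnion]
  cases r with
  | left =>
    refine ⟨F true, (hF true).1, fun z => ⟨fun hz => ?_, ?_⟩⟩
    · refine ⟨fun _ => sigmaEquivUnion F h ⟨true, z, hz⟩, ?_, rfl⟩
      exact congrArg Sigma.fst ((sigmaEquivUnion F h).symm_apply_apply ⟨true, z, hz⟩)
    · rintro ⟨v, hv, rfl⟩
      obtain ⟨⟨b, x⟩, hx⟩ := (sigmaEquivUnion F h).surjective (v 0)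
      have hb : ((sigmaEquivUnion F h).symm (v 0)).1 = true := hv
      rw [← hx, Equiv.symm_apply_apply] at hb
      obtain rfl : b = true := hb
      have : zfTuple (fun i => (v i : ZFSet.{u})) = x := by
        change (v 0 : ZFSet.{u}) = x
        rw [← hx, coe_sigmaEquivUnion]
      rw [this]
      exact x.2
  | rel b r => exact key b _ ((hF b).2.2.2 _ r)
  | graph b f => exact key b _ ((hF b).2.2.1 _ f)

/-- If types in a binary predicate are realized, then disjoint elementarily equivalent internally
presented structures are isomorphic: the type of an isomorphism between the summands is consistent
with the disjoint sum of the structures, because this sum is elementarily equivalent to the sum of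
two copies of one of them. -/
theorem nonempty_equiv_of_disjoint {κ : Cardinal.{u}} (hκ : ℵ₀ ≤ κ)
    (hR : U.RealizesAllTypes κ 2) {L : FirstOrder.Language.{u, u}} (hL : L.card < κ)
    (F : Bool → ZFSet.{u}) (hdisj : ∀ z ∈ F true, z ∉ F false)
    [∀ b, L.Structure (ZFElem (F b))] (hF : ∀ b, U.InternallyPresented L (F b))
    (he : ZFElem (F true) ≅[L] ZFElem (F false)) :
    Nonempty (ZFElem (F true) ≃[L] ZFElem (F false)) := by
  let _ : (pairLang L).Structure (ZFElem (F true ∪ F false)) :=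
    (sigmaEquivUnion F hdisj).inducedStructure
  have e : (Σ b, ZFElem (F b)) ≃[pairLang L] ZFElem (F true ∪ F false) :=
    (sigmaEquivUnion F hdisj).inducedStructureEquiv
  have hne : ∀ b, Nonempty (ZFElem (F b)) := fun b => (hF b).2.1.elim fun x hx => ⟨⟨x, hx⟩⟩
  let N : Type (u + 1) := Σ _ : Bool, ZFElem (F true)
  have hN : N ≅[pairLang L] ZFElem (F true ∪ F false) :=
    (elementarilyEquivalent_pair (fun _ => ZFElem (F true)) (fun b => ZFElem (F b))
      (by rintro (_ | _); exacts [he, rfl])).trans (StrongHomClass.elementarilyEquivalent e)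
  let _ : (newPredLang 2).Structure N :=
    newPredStructure {v | ∃ a, v 0 = ⟨true, a⟩ ∧ v 1 = ⟨false, a⟩}
  have hNne : Nonempty N := ⟨⟨true, (hne true).some⟩⟩
  let Γ : (withPred (pairLang L) 2).Theory := (withPred (pairLang L) 2).completeTheory N
  have hcons : ConsistentWith Γ (ZFElem (F true ∪ F false)) := by
    have h1 : N ⊨ (pairLang L).completeTheory (ZFElem (F true ∪ F false)) := by
      rw [← show (pairLang L).completeTheory N = _ from hN]
      infer_instance
    have h2 : N ⊨ (LHom.sumInl : pairLang L →ᴸ withPred (pairLang L) 2).onTheory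
        ((pairLang L).completeTheory (ZFElem (F true ∪ F false))) :=
      (LHom.onTheory_model _ _).2 h1
    have h3 : N ⊨ Γ ∪ (LHom.sumInl : pairLang L →ᴸ withPred (pairLang L) 2).onTheory
        ((pairLang L).completeTheory (ZFElem (F true ∪ F false))) :=
      Theory.Model.union inferInstance h2
    exact Theory.Model.isSatisfiable N
  obtain ⟨S, hS⟩ := hR (pairLang L) (card_pairLang_lt hκ hL) Γ (Theory.Model.isSatisfiable N)
    (F true ∪ F false) (internallyPresented_union hdisj hF) hcons
  let _ : (newPredLang 2).Structure (ZFElem (F true ∪ F false)) := newPredStructure S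
  have hiso : IsPairIso L (ZFElem (F true ∪ F false)) :=
    (isPairIso_id (ZFElem (F true))).of_model fun φ hφ => hS.realize_of_mem φ hφ
  exact hiso.nonempty_equiv e

theorem isomorphismProperty_of_realizesAllTypes {κ : Cardinal.{u}} (hκ : ℵ₀ ≤ κ)
    (hR : U.RealizesAllTypes κ 2) : U.IsomorphismProperty κ := by
  intro L hL A B instA _ hA hB he
  -- by foundation the copy of `B` is disjoint from `A`
  have hdisj : ∀ z ∈ A, z ∉ B.prod {A} := by
    intro z hz hz'
    obtain ⟨b, -, t, ht, rfl⟩ := ZFSet.mem_prod.1 hz'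
    obtain rfl := ZFSet.mem_singleton.1 ht
    have h1 : t ∈ ({b, t} : ZFSet) := ZFSet.mem_pair.2 (Or.inr rfl)
    have h2 : ({b, t} : ZFSet) ∈ ZFSet.pair b t := ZFSet.mem_pair.2 (Or.inr rfl)
    exact lt_irrefl _ ((ZFSet.rank_lt_of_mem h1).trans
      ((ZFSet.rank_lt_of_mem h2).trans (ZFSet.rank_lt_of_mem hz)))
  let instB : L.Structure (ZFElem (B.prod {A})) := (prodSingletonEquiv B A).inducedStructure
  have e : ZFElem B ≃[L] ZFElem (B.prod {A}) := (prodSingletonEquiv B A).inducedStructureEquiv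
  let _ : ∀ b, L.Structure (ZFElem (cond b A (B.prod {A}))) := fun b =>
    Bool.rec (motive := fun b => L.Structure (ZFElem (cond b A (B.prod {A})))) instB instA b
  obtain ⟨g⟩ := U.nonempty_equiv_of_disjoint hκ hR hL (fun b => cond b A (B.prod {A})) hdisj
    (by rintro (_ | _); exacts [hB.prod_singleton hA.1.1, hA])
    (he.trans (StrongHomClass.elementarilyEquivalent e))
  exact ⟨e.symm.comp g⟩

end NonstandardUniverse

/-! ### Coding small structures in a superstructure -/

theorem lift_beth_le_mk_superstructureLevel {X : ZFSet.{u}}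
    (hX : {x : ZFSet.{u} | x ∈ X}.Infinite) (m : ℕ) :
    Cardinal.lift.{u + 1} (Cardinal.beth.{u} m) ≤ #(ZFElem (superstructureLevel X m)) := by
  induction m with
  | zero =>
    have : Infinite (ZFElem X) := hX.to_subtype
    simp [superstructureLevel]
  | succ m ih =>
    rw [Nat.cast_succ, Cardinal.beth_add_one, Cardinal.lift_power, Cardinal.lift_two]
    refine (Cardinal.power_le_power_left two_ne_zero ih).trans ?_
    rw [← Cardinal.mk_set]
    refine Cardinal.mk_le_of_injective
      (f := fun s => ⟨(superstructureLevel X m).sep fun z => ∃ h, (⟨z, h⟩ : ZFElem _) ∈ s,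
        mem_superstructureLevel_succ.2 (Or.inr ZFSet.sep_subset)⟩) fun s t h => ?_
    ext ⟨z, hz⟩
    have := congrArg (z ∈ ·) (Subtype.mk.inj h)
    simpa [hz] using this

namespace FirstOrder.Language

/-- A structure that is not larger than some level of `V(X)` is isomorphic to a structure coded
in `V(X)`. -/
theorem exists_isCoded {L : FirstOrder.Language.{u, u}} {X : ZFSet.{u}} (hX : IsBaseSet X) {m : ℕ}
    (N : Type u) [L.Structure N]
    (hN : Cardinal.lift.{u + 1} #N ≤ #(ZFElem (superstructureLevel X m))) :
    ∃ (c : L.CodeIndex → superstructure X) (_ : L.Structure (ZFElem (c none : ZFSet.{u}))),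
      IsCoded X c ∧ Nonempty (N ≃[L] ZFElem (c none : ZFSet.{u})) := by
  obtain ⟨g⟩ := Cardinal.lift_mk_le'.1 (hN.trans_eq (Cardinal.lift_id'.{u, u + 1} _).symm)
  let D : ZFSet.{u} := (superstructureLevel X m).sep fun z => ∃ a, (g a : ZFSet.{u}) = z
  have hDm : D ⊆ superstructureLevel X m := ZFSet.sep_subset
  let e : N ≃ ZFElem D := Equiv.ofBijective
    (fun a => ⟨g a, ZFSet.mem_sep.2 ⟨(g a).2, a, rfl⟩⟩) <| by
    constructor
    · exact fun a b h => g.injective (Subtype.ext (Subtype.mk.inj h))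
    · rintro ⟨z, hz⟩
      obtain ⟨-, a, rfl⟩ := ZFSet.mem_sep.1 hz
      exact ⟨a, rfl⟩
  let inst : L.Structure (ZFElem D) := e.inducedStructure
  have hcode : ∀ (n : ℕ) (r : Set (Fin n → ZFElem D)), ∃ R ∈ superstructure X, CodesRel D r R := by
    intro n r
    refine ⟨(superstructureLevel X (m + 2 * n + 1)).sep fun z =>
      ∃ v ∈ r, z = zfTuple fun i => (v i : ZFSet.{u}), ⟨m + 2 * n + 1 + 1,
      mem_superstructureLevel_succ.2 (Or.inr ZFSet.sep_subset)⟩, fun z => ?_⟩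
    refine ZFSet.mem_sep.trans ⟨fun h => h.2, fun h => ⟨?_, h⟩⟩
    obtain ⟨v, -, rfl⟩ := h
    exact zfTuple_mem_superstructureLevel _ fun i => hDm (v i).2
  choose code hcodeX hcode using hcode
  let c : L.CodeIndex → superstructure X := fun o => match o with
    | none => ⟨D, m + 1, mem_superstructureLevel_succ.2 (Or.inr hDm)⟩
    | some (Sum.inl f) =>
      ⟨code (f.1 + 1) (_root_.graphRel fun v => Structure.funMap f.2 v), hcodeX _ _⟩
    | some (Sum.inr r) => ⟨code r.1 {v | Structure.RelMap r.2 v}, hcodeX _ _⟩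
  exact ⟨c, inst, ⟨hX.notMem_of_subset_level hDm, fun n f => hcode _ _, fun n r => hcode _ _⟩,
    ⟨e.inducedStructureEquiv⟩⟩

theorem card_withPred_le {L : FirstOrder.Language.{u, u}} {n : ℕ} {κ : Cardinal.{u}} (hκ : ℵ₀ ≤ κ)
    (h : L.card ≤ κ) : (withPred L n).card ≤ κ := by
  have : Countable (newPredLang n).Symbols := by
    refine Function.Injective.countable (f := fun _ => ()) ?_
    rintro (⟨_, ⟨⟩⟩ | ⟨_, ⟨⟩⟩) (⟨_, ⟨⟩⟩ | ⟨_, ⟨⟩⟩) -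
    rfl
  have h' : (newPredLang n).card ≤ ℵ₀ := Cardinal.mk_le_aleph0
  rw [withPred, Language.card_sum]
  refine Cardinal.add_le_of_le hκ (by simpa using h) (le_trans ?_ hκ)
  simpa using h'

/-- Löwenheim–Skolem: a satisfiable theory has a model not larger than a given infinite bound for
the cardinality of its language. -/
theorem Theory.IsSatisfiable.exists_model_card_le {L : FirstOrder.Language.{u, u}} {T : L.Theory}
    (h : T.IsSatisfiable) {κ : Cardinal.{u}} (hκ : ℵ₀ ≤ κ) (hL : L.card ≤ κ) :
    ∃ (N : Type u) (_ : L.Structure N), Nonempty N ∧ N ⊨ T ∧ #N ≤ κ := by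
  obtain ⟨N⟩ := h
  rcases le_total #N κ with hN | hN
  · exact ⟨N, inferInstance, inferInstance, inferInstance, hN⟩
  · obtain ⟨S, -, hS⟩ := exists_elementarySubstructure_card_eq L (∅ : Set N) κ hκ (by simp)
      (by simpa using hL) (by simpa using hN)
    exact ⟨S, inferInstance, inferInstance, inferInstance, by simpa using hS.le⟩

end FirstOrder.Language

theorem exists_nat_lt_beth {κ : Cardinal.{u}} (h : κ < Cardinal.beth Ordinal.omega0) :
    ∃ m : ℕ, κ < Cardinal.beth m := by
  rw [Cardinal.beth_limit Ordinal.isSuccLimit_omega0] at h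
  obtain ⟨⟨a, ha⟩, h⟩ := exists_lt_of_lt_ciSup' h
  obtain ⟨m, rfl⟩ := Ordinal.lt_omega0.1 ha
  exact ⟨m, h⟩

namespace NonstandardUniverse

open FirstOrder.Language

variable (U : NonstandardUniverse.{u})

/-! ### The isomorphism property implies realizing types -/

/-- Below `ℶ_ω` a model of the type and of the theory of the given structure can be found in
`V(X)`; its nonstandard extension is internally presented, and the isomorphism property carries
the interpretation of the new predicate over to the given structure. -/
theorem realizesAllTypes_of_isomorphismProperty {κ : Cardinal.{u}}
    (hκ' : κ < Cardinal.beth Ordinal.omega0) (hIP : U.IsomorphismProperty κ) (n : ℕ) :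
    U.RealizesAllTypes κ n := by
  intro L hL Γ _ A instA hA hcons
  obtain ⟨m, hm⟩ := exists_nat_lt_beth hκ'
  have hm0 := Cardinal.aleph0_le_beth (m : Ordinal.{u})
  obtain ⟨N, _, _, hN, hNm⟩ := hcons.exists_model_card_le hm0
    (card_withPred_le hm0 (hL.trans hm).le)
  obtain ⟨c, _, hc, ⟨e⟩⟩ := exists_isCoded (L := withPred L n) U.isBaseSet_X (m := m) N
    ((Cardinal.lift_le.2 hNm).trans (lift_beth_le_mk_superstructureLevel U.infinite_X m))
  obtain ⟨inst, hint, hequiv⟩ := U.exists_star_model c hc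
    ⟨_, (e.toEquiv (Classical.arbitrary N)).2⟩
  have hmodel : ZFElem (U.star (c none) : ZFSet.{u}) ⊨
      Γ ∪ (LHom.sumInl : L →ᴸ withPred L n).onTheory (L.completeTheory (ZFElem A)) :=
    ((StrongHomClass.elementarilyEquivalent e).trans hequiv).theory_model
  let instL : L.Structure (ZFElem (U.star (c none) : ZFSet.{u})) :=
    (LHom.sumInl : L →ᴸ withPred L n).reduct _
  have hTh : ZFElem (U.star (c none) : ZFSet.{u}) ⊨ L.completeTheory (ZFElem A) :=
    (LHom.onTheory_model (LHom.sumInl : L →ᴸ withPred L n) _).1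
      (hmodel.mono Set.subset_union_right)
  have hequivL : ZFElem (U.star (c none) : ZFSet.{u}) ≅[L] ZFElem A :=
    elementarilyEquivalent_iff.2 fun φ =>
      realize_iff_of_model_completeTheory (ZFElem A) (ZFElem (U.star (c none) : ZFSet.{u})) φ
  obtain ⟨g⟩ := hIP L hL _ A ⟨hint.1, hint.2.1, fun k f => hint.2.2.1 k (Sum.inl f),
    fun k r => hint.2.2.2 k (Sum.inl r)⟩ hA hequivL
  let S : Set (Fin n → ZFElem A) := {v | Structure.RelMap (newSymbol L n) (g.symm ∘ v)}
  refine ⟨S, ?_⟩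
  let _ : (newPredLang n).Structure (ZFElem A) := newPredStructure S
  let g' : ZFElem (U.star (c none) : ZFSet.{u}) ≃[withPred L n] ZFElem A :=
    { g.toEquiv with
      map_fun' := by
        rintro k (f | f) x
        · exact g.map_fun f x
        · exact f.elim
      map_rel' := by
        rintro k (r | r) x
        · exact g.map_rel r x
        · cases r
          change Structure.RelMap (newSymbol L n) (g.symm ∘ (g ∘ x)) ↔
            Structure.RelMap (newSymbol L n) x
          rw [← Function.comp_assoc]
          simp [Function.comp_def] }
  have hΓ : ZFElem (U.star (c none) : ZFSet.{u}) ⊨ Γ := hmodel.mono Set.subset_union_left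
  exact StrongHomClass.theory_model g'

end NonstandardUniverse

/-! ### Realizing unary types implies saturation -/

/-- Unary predicate symbols indexed by `I`. -/
inductive UnaryRel (I : Type u) : ℕ → Type u
  | mk (i : I) : UnaryRel I 1

/-- The language with the unary predicate symbols indexed by `I`. -/
def unaryLang (I : Type u) : FirstOrder.Language.{u, u} where
  Functions := fun _ => PEmpty
  Relations := UnaryRel I

/-- The unary predicates on `M` given by a family of sets. -/
@[reducible]
def unaryStructure {I : Type u} {M : Type*} (P : I → Set M) : (unaryLang I).Structure M where
  funMap f := PEmpty.elim f
  RelMap r v := match r with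
    | UnaryRel.mk i => v 0 ∈ P i

theorem card_unaryLang (I : Type u) : (unaryLang I).card = #I := by
  refine Cardinal.mk_congr
    ⟨fun s => match s with
      | Sum.inl f => PEmpty.elim f.2
      | Sum.inr ⟨_, UnaryRel.mk i⟩ => i, fun i => Sum.inr ⟨1, UnaryRel.mk i⟩, ?_, fun _ => rfl⟩
  rintro (⟨_, ⟨⟩⟩ | ⟨_, ⟨⟩⟩)
  rfl

section UnarySentences

open FirstOrder.Language

variable (L : FirstOrder.Language.{u, u})

/-- The sentence `∃ x, X x`. -/
def nonemptySentence : (withPred L 1).Sentence :=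
  (Relations.boundedFormula₁ (newSymbol L 1) (&0)).ex

variable {L}

/-- The sentence `∀ x (X x → R x)`. -/
def subsetSentence (R : L.Relations 1) : (withPred L 1).Sentence :=
  ((Relations.boundedFormula₁ (newSymbol L 1) (&0)).imp
    (Relations.boundedFormula₁ (oldSymbol 1 R) (&0))).all

variable {K : Type*} [L.Structure K] [(newPredLang 1).Structure K]

theorem realize_nonemptySentence :
    K ⊨ nonemptySentence L ↔ ∃ x : K, Structure.RelMap (L := newPredLang 1) NewPred.X ![x] := by
  simp only [nonemptySentence, Sentence.Realize, Formula.Realize, BoundedFormula.realize_ex,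
    BoundedFormula.realize_rel₁]
  rfl

theorem realize_subsetSentence (R : L.Relations 1) :
    K ⊨ subsetSentence R ↔ ∀ x : K, Structure.RelMap (L := newPredLang 1) NewPred.X ![x] →
      Structure.RelMap R ![x] := by
  simp only [subsetSentence, Sentence.Realize, Formula.Realize, BoundedFormula.realize_all,
    BoundedFormula.realize_imp, BoundedFormula.realize_rel₁]
  rfl

end UnarySentences

namespace NonstandardUniverse

open FirstOrder.Language

variable (U : NonstandardUniverse.{u})

/-- A common element of the sets `F i` is an element of a realization of the type of a nonempty
set contained in all of them. -/
theorem saturated_of_realizesAllTypes {κ : Cardinal.{u}} (hR : U.RealizesAllTypes κ 1) :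
    U.Saturated κ := by
  classical
  intro I F hI hF hfip
  rcases isEmpty_or_nonempty I with _ | ⟨⟨i₀⟩⟩
  · exact ⟨∅, fun i => isEmptyElim i⟩
  have : Nonempty I := ⟨i₀⟩
  let inst : (unaryLang I).Structure (ZFElem (F i₀)) :=
    unaryStructure fun i => {x | (x : ZFSet.{u}) ∈ F i}
  have hne : (F i₀).Nonempty := (hfip {i₀}).imp fun x hx => hx i₀ (Finset.mem_singleton_self _)
  have : Nonempty (ZFElem (F i₀)) := hne.elim fun x hx => ⟨⟨x, hx⟩⟩
  have hint : U.InternallyPresented (unaryLang I) (F i₀) := by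
    refine ⟨hF i₀, hne, fun n f => PEmpty.elim f, fun n r => ?_⟩
    cases r with
    | mk i =>
      refine ⟨F i₀ ∩ F i, (hF i₀).inter (hF i), fun z => ⟨fun hz => ?_, ?_⟩⟩
      · exact ⟨fun _ => ⟨z, (ZFSet.mem_inter.1 hz).1⟩, (ZFSet.mem_inter.1 hz).2, rfl⟩
      · rintro ⟨v, hv, rfl⟩
        exact ZFSet.mem_inter.2 ⟨(v 0).2, hv⟩
  let Γ : (withPred (unaryLang I) 1).Theory :=
    ⋃ i, {nonemptySentence (unaryLang I), subsetSentence (L := unaryLang I) (UnaryRel.mk i)}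
  have hcons : ConsistentWith Γ (ZFElem (F i₀)) := by
    unfold ConsistentWith
    rw [Set.iUnion_union, Theory.isSatisfiable_iUnion_iff_isSatisfiable_iUnion_finset]
    intro s
    obtain ⟨x, hx⟩ := hfip (insert i₀ s)
    let _ : (newPredLang 1).Structure (ZFElem (F i₀)) :=
      newPredStructure {v | (v 0 : ZFSet.{u}) = x}
    have : ZFElem (F i₀) ⊨ ⋃ i ∈ s, ({nonemptySentence (unaryLang I),
        subsetSentence (L := unaryLang I) (UnaryRel.mk i)} ∪
        (LHom.sumInl : unaryLang I →ᴸ withPred (unaryLang I) 1).onTheory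
          ((unaryLang I).completeTheory (ZFElem (F i₀)))) := by
      refine ⟨fun φ hφ => ?_⟩
      simp only [Set.mem_iUnion] at hφ
      obtain ⟨i, hi, (rfl | rfl) | hφ⟩ := hφ
      · exact realize_nonemptySentence.2 ⟨⟨x, hx i₀ (Finset.mem_insert_self _ _)⟩, rfl⟩
      · refine (realize_subsetSentence _).2 fun y hy => ?_
        have hy' : (y : ZFSet.{u}) = x := hy
        change (y : ZFSet.{u}) ∈ F i
        rw [hy']
        exact hx i (Finset.mem_insert_of_mem hi)
      · exact ((LHom.onTheory_model (M := ZFElem (F i₀))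
          (LHom.sumInl : unaryLang I →ᴸ withPred (unaryLang I) 1) _).2
            inferInstance).realize_of_mem φ hφ
    exact Theory.Model.isSatisfiable (ZFElem (F i₀))
  obtain ⟨S, hS⟩ := hR (unaryLang I) (by rwa [card_unaryLang]) Γ
    (hcons.mono Set.subset_union_left) (F i₀) hint hcons
  let _ : (newPredLang 1).Structure (ZFElem (F i₀)) := newPredStructure S
  obtain ⟨x, hx⟩ := realize_nonemptySentence.1
    (hS.realize_of_mem _ (Set.mem_iUnion.2 ⟨i₀, Or.inl rfl⟩))
  exact ⟨x, fun i => (realize_subsetSentence _).1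
    (hS.realize_of_mem _ (Set.mem_iUnion.2 ⟨i, Or.inr rfl⟩)) x hx⟩

end NonstandardUniverse

theorem mainTheorem1 (U : NonstandardUniverse.{u}) (κ : Cardinal.{u}) (hκ : κ.IsRegular) :
    (κ < Cardinal.beth Ordinal.omega0 →
      (U.IsomorphismProperty κ ↔ ∀ n : ℕ, U.RealizesAllTypes κ n)) ∧
    (U.RealizesAllTypes κ 2 → U.IsomorphismProperty κ) ∧
    (κ < Cardinal.beth Ordinal.omega0 → U.IsomorphismProperty κ → U.Saturated κ) :=
  ⟨fun h => ⟨fun hIP n => U.realizesAllTypes_of_isomorphismProperty h hIP n,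
      fun hR => U.isomorphismProperty_of_realizesAllTypes hκ.aleph0_le (hR 2)⟩,
    U.isomorphismProperty_of_realizesAllTypes hκ.aleph0_le,
    fun h hIP => U.saturated_of_realizesAllTypes
      (U.realizesAllTypes_of_isomorphismProperty h hIP 1)⟩
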